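/- Coalitional Manipulation for ranked pairs: given $m\ge 1$ candidates, a distinguished candidate $c$, a list $V$ of complete votes (linear orders) of the non-manipulators and a number $|M|$ of manipulators, decide whether the manipulators can cast votes such that $c$ is the unique ranked pairs winner (i.e. the winner under every way of breaking ties). The parameter is $m$. For a list of votes, let the margin $D(a,b)$ be the number of votes preferring $a$ to $b$ minus the number of votes preferring $b$ to $a$. Theorem. For every polynomial $p$, the problem restricted to instances with $|M|\le p(m)$ admits a polynomial kernel: there is a polynomial-time algorithm that maps each such instance to an equivalent such instance whose total size and parameter are bounded by a polynomial in $m$. Moreover, it can be chosen so that, with an absolute constant $C$ (independent of $p$ and of the instance), the algorithm keeps the candidates, $c$ and $|M|$, and only replaces $V$ by a list $V'$ such that 1. $|V'|+|M|\le C\,m^4\max(1,|M|)$, so that for $|M|\ge 1$ the kernel has $O(m^4|M|)$ votes; 2. each margin $D_{V'}(a,b)$ differs from $D_V(a,b)$ by an even number; 3. when $0$ and the positive margins of $V'$ are sorted, consecutive values differ by at most $2|M|+2$; 4. for every list $T$ of $|M|$ votes of the manipulators and all candidates $a,b,x,y$, we have $D(a,b)>D(x,y)$ for the votes $V$ together with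 $T$ if and only if $D(a,b)>D(x,y)$ for the votes $V'$ together with $T$. -/

import Mathlib

/-! ### Parameterized problems and kernels -/

/-- A parameterized problem: instances are written as words over `{0,1}` (by an injective
encoding), every instance has a parameter, and some of the instances are YES-instances. -/
structure ParamProblem where
  /-- the instances -/
  Inst : Type
  /-- the word that describes an instance -/
  encode : Inst → List Bool
  /-- different instances are described by different words -/
  encode_injective : Function.Injective encode
  /-- the parameter of an instance -/
  param : Inst → ℕ
  /-- the YES-instances -/
  yes : Set Inst

/-- `f` is a kernelization algorithm of polynomial size for `P`: it is computed by a Turing machine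
in time polynomial in the length of the input word (in the problem below the parameter is at most
this length), it maps instances of `P` to equivalent
instances of `P`, and both the length and the parameter of the output are bounded by a
polynomial in the parameter of the input. -/
def ParamProblem.IsPolynomialKernelization (P : ParamProblem) (f : P.Inst → P.Inst) : Prop :=
  Nonempty (Turing.TM2ComputableInPolyTime P.encode P.encode f) ∧
  (∀ x, x ∈ P.yes ↔ f x ∈ P.yes) ∧
  ∃ g : Polynomial ℕ, ∀ x,
    (P.encode (f x)).length ≤ g.eval (P.param x) ∧ P.param (f x) ≤ g.eval (P.param x)

/-! ### Votes and voting rules -/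

/-- A vote over the candidates `Fin m`: a linear order, given by listing the candidates from the
most preferred one (`v 0`) to the least preferred one (`v (m - 1)`). -/
abbrev Vote (m : ℕ) : Type := Equiv.Perm (Fin m)

/-- The vote `v` ranks `a` strictly before `b`. -/
def Vote.Prefers {m : ℕ} (v : Vote m) (a b : Fin m) : Prop := v.symm a < v.symm b

instance {m : ℕ} (v : Vote m) (a b : Fin m) : Decidable (v.Prefers a b) :=
  inferInstanceAs (Decidable (v.symm a < v.symm b))

/-- `D(a, b) = N(a, b) - N(b, a)`, the weight of `(a, b)` in the weighted majority graph. -/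
def margin {m : ℕ} (V : List (Vote m)) (a b : Fin m) : ℤ :=
  (V.countP (fun v => v.Prefers a b) : ℤ) - (V.countP (fun v => v.Prefers b a) : ℤ)

/-- A voting rule assigns a set of winners to every profile. -/
abbrev VotingRule : Type := (m : ℕ) → List (Vote m) → Set (Fin m)

/-- A possible order in which ranked pairs considers the pairs of distinct candidates: every
such pair once, by non-increasing weight, ties being broken arbitrarily. -/
def IsPairOrder {m : ℕ} (D : Fin m → Fin m → ℤ) (L : List (Fin m × Fin m)) : Prop :=
  L.Nodup ∧ (∀ q, q ∈ L ↔ q.1 ≠ q.2) ∧ L.Pairwise (fun q q' => D q'.1 q'.2 ≤ D q.1 q.2)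

/-- One step of ranked pairs: fix `q.1 ≻ q.2`, unless this contradicts the orderings `R` fixed
so far, that is, unless they already force `q.2` to be before `q.1`. -/
def lockStep {m : ℕ} (R : Set (Fin m × Fin m)) (q : Fin m × Fin m) : Set (Fin m × Fin m) :=
  {e | e ∈ R ∨ (e = q ∧ ¬ Relation.ReflTransGen (fun x y => (x, y) ∈ R) q.2 q.1)}

/-- The orderings that ranked pairs has fixed after it has considered the pairs of `L` in turn. -/
def lockedPairs {m : ℕ} (L : List (Fin m × Fin m)) : Set (Fin m × Fin m) :=
  L.foldl lockStep ∅

/-- The ranked pairs rule with parallel-universes tie breaking: `c` is a winner if, for some way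
of breaking the ties, `c` is at the top of the resulting order. -/
def rankedPairs : VotingRule := fun _ V =>
  {c | ∃ L, IsPairOrder (margin V) L ∧
    ∀ x, x ≠ c → Relation.TransGen (fun a b => (a, b) ∈ lockedPairs L) c x}

/-! ### Coalitional manipulation -/

/-- An instance of coalitional manipulation. -/
structure CMInstance where
  /-- the number of candidates; the candidates are the elements of `Fin m` -/
  m : ℕ
  /-- the candidate whom the manipulators want to win -/
  c : Fin m
  /-- the number of manipulators -/
  numManip : ℕ
  /-- the votes of the non-manipulators -/
  votes : List (Vote m)

/-- The manipulators can vote so that `c` is the only winner. -/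
def CMInstance.Yes (r : VotingRule) (I : CMInstance) : Prop :=
  ∃ T : List (Vote I.m), T.length = I.numManip ∧ r I.m (I.votes ++ T) = {I.c}

/-- The word `1 … 1 0` with `n` ones. -/
def encodeUnary (n : ℕ) : List Bool := List.replicate n true ++ [false]

/-- A vote is written as the list of its candidates, from first to last. -/
def encodeVote {m : ℕ} (v : Vote m) : List Bool :=
  (List.finRange m).flatMap fun i => encodeUnary (v i)

/-- An instance is written as a word. The votes are listed one by one, each one as a list of
candidates; the manipulators are voters too, so their number is written in unary. -/
def CMInstance.encode (I : CMInstance) : List Bool :=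
  encodeUnary I.m ++ (encodeUnary I.c ++ (encodeUnary I.numManip ++
    (encodeUnary I.votes.length ++ I.votes.flatMap encodeVote)))

theorem encodeUnary_append_inj {a b : ℕ} {l l' : List Bool}
    (h : encodeUnary a ++ l = encodeUnary b ++ l') : a = b ∧ l = l' := by
  induction a generalizing b with
  | zero =>
    cases b with
    | zero => simpa [encodeUnary] using h
    | succ b => simp [encodeUnary, List.replicate_succ] at h
  | succ a ih =>
    cases b with
    | zero => simp [encodeUnary, List.replicate_succ] at h
    | succ b =>
      have h' : encodeUnary a ++ l = encodeUnary b ++ l' := by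
        simpa [encodeUnary, List.replicate_succ] using h
      obtain ⟨h1, h2⟩ := ih h'
      exact ⟨by rw [h1], h2⟩

theorem encodeUnary_flatMap_append_inj {m : ℕ} (v w : Fin m → Fin m) (s : List (Fin m))
    {l l' : List Bool}
    (h : (s.flatMap fun i => encodeUnary (v i)) ++ l =
      (s.flatMap fun i => encodeUnary (w i)) ++ l') :
    (∀ i ∈ s, v i = w i) ∧ l = l' := by
  induction s with
  | nil => simpa using h
  | cons i s ih =>
    simp only [List.flatMap_cons, List.append_assoc] at h
    obtain ⟨h1, h2⟩ := encodeUnary_append_inj h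
    obtain ⟨h3, h4⟩ := ih h2
    refine ⟨?_, h4⟩
    intro j hj
    rcases List.mem_cons.1 hj with rfl | hj
    · exact Fin.ext h1
    · exact h3 j hj

theorem encodeVote_append_inj {m : ℕ} {v w : Vote m} {l l' : List Bool}
    (h : encodeVote v ++ l = encodeVote w ++ l') : v = w ∧ l = l' := by
  obtain ⟨h1, h2⟩ := encodeUnary_flatMap_append_inj v w _ h
  exact ⟨Equiv.ext fun i => h1 i (List.mem_finRange i), h2⟩

theorem encodeVote_flatMap_inj {m : ℕ} {V W : List (Vote m)} (hl : V.length = W.length)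
    (h : V.flatMap encodeVote = W.flatMap encodeVote) : V = W := by
  induction V generalizing W with
  | nil => exact (List.length_eq_zero_iff.1 hl.symm).symm
  | cons v V ih =>
    cases W with
    | nil => simp at hl
    | cons w W =>
      simp only [List.flatMap_cons] at h
      obtain ⟨h1, h2⟩ := encodeVote_append_inj h
      rw [h1, ih (by simpa using hl) h2]

theorem CMInstance.encode_injective : Function.Injective CMInstance.encode := by
  rintro ⟨m, c, k, V⟩ ⟨m', c', k', V'⟩ h
  simp only [CMInstance.encode] at h
  obtain ⟨rfl, h1⟩ := encodeUnary_append_inj h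
  obtain ⟨hc, h2⟩ := encodeUnary_append_inj h1
  obtain ⟨rfl, h3⟩ := encodeUnary_append_inj h2
  obtain ⟨hl, h4⟩ := encodeUnary_append_inj h3
  obtain rfl := Fin.ext hc
  obtain rfl := encodeVote_flatMap_inj hl h4
  rfl

/-- Coalitional manipulation for the rule `r`, parameterized by the number `m` of candidates, and
restricted to the instances with at most `p(m)` manipulators. -/
def coalitionalManipulation (r : VotingRule) (p : Polynomial ℕ) : ParamProblem where
  Inst := {I : CMInstance // I.numManip ≤ p.eval I.m}
  encode I := I.1.encode
  encode_injective := CMInstance.encode_injective.comp Subtype.val_injective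
  param I := I.1.m
  yes := {I | I.1.Yes r}

/-! Let n be the number of votes in V and M the number of manipulators. A positive margin D(a,b)
equals 2p - (n mod 2) for a natural number p, its level; 0 counts as a level too. M further votes
change the difference of two margins by at most 2M, so a difference of more than 2M is never
overturned and its exact size is irrelevant. The kernel therefore compresses the scale of levels: a
unit t survives only if it is among the M + 1 units that start at some level (`Kept`), and p is
replaced by the number of surviving units below p (`keptBelow`). A gap of at most M + 1 units
between levels is unchanged. A larger gap has at least M + 1 units afterwards, that is, 2M + 2 in
margin (`keptBelow_dichotomy`). Margins of opposite signs are compared through the level 0. So every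
comparison of margins survives every choice of the manipulators' votes, and ranked pairs depends on
nothing else (`rankedPairs_congr`). Since p only becomes another p, parities agree.

There are at most m² + 1 levels, so each new level is at most (m² + 1)(M + 1) (`keptBelow_le`). By
McGarvey's construction two votes raise one margin by 2 and leave all other pairs alone
(`exists_votePair`); for odd n, one vote 0 ≻ 1 ≻ ⋯ corrects the parity. This gives O(m⁴ max(1, M))
votes.

Polynomial time is shown without writing a machine by hand. A small language of terms (`WordTerm`)
with bounded concatenation, truncated subtraction and access to the input bits compiles to
structured stack programs with polynomial running time, and these compile to Turing machines
(`Runs.leads`). Sums, comparisons and bounded quantifiers are expressible, so the code of the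
kernel, written out as `kernelWord`, is denoted by a term. -/

/-! ### Structured programs on stacks of bits -/

/-- Structured programs that work on stacks of bits, numbered by `ℕ`. -/
inductive StackProg
  | skip : StackProg
  | push : ℕ → Bool → StackProg
  | seq : StackProg → StackProg → StackProg
  /-- pop a bit and branch according to the result `true`, `false` or `none` -/
  | case : ℕ → StackProg → StackProg → StackProg → StackProg
  /-- pop bits as long as there are any; run the first program for every `true` and the second
  one for every `false` -/
  | loop : ℕ → StackProg → StackProg → StackProg

namespace StackProg

open Function Turing

/-- `Runs c S S' t`: started with the stacks `S`, the program `c` ends with the stacks `S'` after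
`t` steps. -/
inductive Runs : StackProg → (ℕ → List Bool) → (ℕ → List Bool) → ℕ → Prop
  | skip S : Runs skip S S 1
  | push k b S : Runs (push k b) S (update S k (b :: S k)) 1
  | seq {a b S S' S'' t t'} : Runs a S S' t → Runs b S' S'' t' → Runs (seq a b) S S'' (t + t')
  | caseTrue {k a b e S S' t l} : S k = true :: l → Runs a (update S k l) S' t →
      Runs (case k a b e) S S' (1 + t)
  | caseFalse {k a b e S S' t l} : S k = false :: l → Runs b (update S k l) S' t →
      Runs (case k a b e) S S' (1 + t)
  | caseNone {k a b e S S' t} : S k = [] → Runs e S S' t → Runs (case k a b e) S S' (1 + t)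
  | loopTrue {k a b S S' S'' t t' l} : S k = true :: l → Runs a (update S k l) S' t →
      Runs (loop k a b) S' S'' t' → Runs (loop k a b) S S'' (1 + t + t')
  | loopFalse {k a b S S' S'' t t' l} : S k = false :: l → Runs b (update S k l) S' t →
      Runs (loop k a b) S' S'' t' → Runs (loop k a b) S S'' (1 + t + t')
  | loopNone {k a b S} : S k = [] → Runs (loop k a b) S S 1

theorem Runs.congr {c : StackProg} {S₀ S S' S₁ : ℕ → List Bool} {t : ℕ} (h : Runs c S S' t)
    (h₀ : S = S₀) (h₁ : S' = S₁) : Runs c S₀ S₁ t := h₀ ▸ h₁ ▸ h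

/-- All stacks that the program mentions have numbers at most this bound. -/
def maxStack : StackProg → ℕ
  | skip => 0
  | push k _ => k
  | seq a b => max a.maxStack b.maxStack
  | case k a b e => max (max k a.maxStack) (max b.maxStack e.maxStack)
  | loop k a b => max k (max a.maxStack b.maxStack)

/-! ### Compiling stack programs to Turing machines. -/

/-- The labels of the Turing machine that executes the program. -/
def Label : StackProg → Type
  | skip => Unit
  | push _ _ => Unit
  | seq a b => a.Label ⊕ b.Label
  | case _ a b e => Option (a.Label ⊕ b.Label ⊕ e.Label)
  | loop _ a b => Option (a.Label ⊕ b.Label)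

/-- The label where the execution of the program starts. -/
def entry : (c : StackProg) → c.Label
  | skip => ()
  | push _ _ => ()
  | seq a _ => Sum.inl a.entry
  | case _ _ _ _ => none
  | loop _ _ _ => none

instance finiteLabel : (c : StackProg) → Finite c.Label
  | skip => inferInstanceAs (Finite Unit)
  | push _ _ => inferInstanceAs (Finite Unit)
  | seq a b =>
    have := finiteLabel a
    have := finiteLabel b
    inferInstanceAs (Finite (a.Label ⊕ b.Label))
  | case _ a b e =>
    have := finiteLabel a
    have := finiteLabel b
    have := finiteLabel e
    inferInstanceAs (Finite (Option (a.Label ⊕ b.Label ⊕ e.Label)))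
  | loop _ a b =>
    have := finiteLabel a
    have := finiteLabel b
    inferInstanceAs (Finite (Option (a.Label ⊕ b.Label)))

/-- Statements of a machine with `N + 1` stacks of bits that remembers the last bit popped. -/
abbrev MachineStmt (N : ℕ) (Λ : Type) : Type :=
  TM2.Stmt (fun _ : Fin (N + 1) => Bool) Λ (Option Bool)

/-- Pop a bit and jump according to the result. -/
def popJump {N : ℕ} {Λ : Type} (k : ℕ) (lt lf ln : Λ) : MachineStmt N Λ :=
  .pop (Fin.ofNat (N + 1) k) (fun _ o => o) (.goto fun o => o.elim ln fun b => cond b lt lf)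

/-- The statements that execute a program, when its labels are embedded into the labels of a larger
machine, and the machine continues at the label `exit` afterwards. -/
def stmt {N : ℕ} {Λ : Type} : (c : StackProg) → (c.Label → Λ) → Λ → c.Label → MachineStmt N Λ
  | skip, _, exit, _ => .goto fun _ => exit
  | push k b, _, exit, _ => .push (Fin.ofNat (N + 1) k) (fun _ => b) (.goto fun _ => exit)
  | seq a b, emb, exit, l =>
    match l with
    | Sum.inl l => a.stmt (fun l => emb (Sum.inl l)) (emb (Sum.inr b.entry)) l
    | Sum.inr l => b.stmt (fun l => emb (Sum.inr l)) exit l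
  | case k a b e, emb, exit, l =>
    match l with
    | none => popJump k (emb (some (Sum.inl a.entry))) (emb (some (Sum.inr (Sum.inl b.entry))))
        (emb (some (Sum.inr (Sum.inr e.entry))))
    | some (Sum.inl l) => a.stmt (fun l => emb (some (Sum.inl l))) exit l
    | some (Sum.inr (Sum.inl l)) => b.stmt (fun l => emb (some (Sum.inr (Sum.inl l)))) exit l
    | some (Sum.inr (Sum.inr l)) => e.stmt (fun l => emb (some (Sum.inr (Sum.inr l)))) exit l
  | loop k a b, emb, exit, l =>
    match l with
    | none => popJump k (emb (some (Sum.inl a.entry))) (emb (some (Sum.inr b.entry))) exit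
    | some (Sum.inl l) => a.stmt (fun l => emb (some (Sum.inl l))) (emb none) l
    | some (Sum.inr l) => b.stmt (fun l => emb (some (Sum.inr l))) (emb none) l

/-- The machine goes from the first to the second configuration in `t` steps. -/
def Leads {N : ℕ} {Λ : Type} (M : Λ → MachineStmt N Λ) (t : ℕ)
    (x y : TM2.Cfg (fun _ : Fin (N + 1) => Bool) Λ (Option Bool)) : Prop :=
  (flip bind (TM2.step M))^[t] (some x) = some y

theorem iterate_eq_trans {α : Type*} {g : α → α} {x y z : α} {t t' : ℕ} (h : g^[t] x = y)
    (h' : g^[t'] y = z) : g^[t + t'] x = z := by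
  rw [add_comm, Function.iterate_add_apply, h, h']

theorem Leads.trans {N : ℕ} {Λ : Type} {M : Λ → MachineStmt N Λ} {t t' : ℕ}
    {x y z : TM2.Cfg (fun _ : Fin (N + 1) => Bool) Λ (Option Bool)}
    (h : Leads M t x y) (h' : Leads M t' y z) : Leads M (t + t') x z :=
  iterate_eq_trans h h'

theorem leads_one {N : ℕ} {Λ : Type} {M : Λ → MachineStmt N Λ}
    {x y : TM2.Cfg (fun _ : Fin (N + 1) => Bool) Λ (Option Bool)}
    (h : TM2.step M x = some y) : Leads M 1 x y := h

/-- The stacks with numbers up to `N`. -/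
def restrict (N : ℕ) (S : ℕ → List Bool) (k : Fin (N + 1)) : List Bool := S k

theorem restrict_ofNat {N k : ℕ} (hk : k ≤ N) (S : ℕ → List Bool) :
    restrict N S (Fin.ofNat (N + 1) k) = S k := by
  simp [restrict, Nat.mod_eq_of_lt (Nat.lt_succ_of_le hk)]

theorem update_restrict {N k : ℕ} (hk : k ≤ N) (S : ℕ → List Bool) (l : List Bool) :
    update (restrict N S) (Fin.ofNat (N + 1) k) l = restrict N (update S k l) := by
  have hk' : k % (N + 1) = k := Nat.mod_eq_of_lt (Nat.lt_succ_of_le hk)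
  funext i
  by_cases h : (i : ℕ) = k
  · have hi : i = Fin.ofNat (N + 1) k := Fin.ext (by simp [h, hk'])
    rw [hi, update_self, restrict_ofNat hk, update_self]
  · have hi : i ≠ Fin.ofNat (N + 1) k := fun e => h (by rw [e]; simp [hk'])
    rw [update_of_ne hi, restrict, restrict, update_of_ne h]

theorem restrict_update_self {N j : ℕ} (hj : j ≤ N) (l : List Bool) :
    restrict N (update (fun _ => []) j l) (Fin.ofNat (N + 1) j) = l := by
  rw [restrict_ofNat hj, update_self]

theorem restrict_update_of_ne {N j : ℕ} (hj : j ≤ N) (l : List Bool) {k : Fin (N + 1)}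
    (hk : k ≠ Fin.ofNat (N + 1) j) : restrict N (update (fun _ => []) j l) k = [] := by
  rw [← update_restrict hj, update_of_ne hk]
  rfl

theorem leads_popJump {N : ℕ} {Λ : Type} {M : Λ → MachineStmt N Λ} {k : ℕ} (hk : k ≤ N)
    {l lt lf ln : Λ} (hl : M l = popJump k lt lf ln) (v : Option Bool) (S : ℕ → List Bool) :
    Leads M 1 ⟨some l, v, restrict N S⟩
      ⟨some ((S k).head?.elim ln fun b => cond b lt lf), (S k).head?,
        restrict N (update S k (S k).tail)⟩ := by
  refine leads_one ?_
  simp only [TM2.step, hl, popJump, TM2.stepAux, restrict_ofNat hk, update_restrict hk]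

/-- Induction on the run. The embedding of the labels and the exit are arbitrary so that the
induction hypothesis applies to subprograms: the first part of a sequence exits into the second, a
loop body into the head of its loop. The remembered bit may be anything before and after, because
every jump that reads it has just overwritten it. Program steps and machine steps agree exactly. -/
theorem Runs.leads {N : ℕ} {Λ : Type} {M : Λ → MachineStmt N Λ} {c : StackProg}
    {S S' : ℕ → List Bool} {t : ℕ} (h : Runs c S S' t) (hN : c.maxStack ≤ N)
    {emb : c.Label → Λ} {exit : Λ} (hM : ∀ l, M (emb l) = c.stmt emb exit l) (v : Option Bool) :
    ∃ v', Leads M t ⟨some (emb c.entry), v, restrict N S⟩ ⟨some exit, v', restrict N S'⟩ := by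
  induction h generalizing v exit with
  | skip S =>
    refine ⟨v, leads_one ?_⟩
    simp only [TM2.step, hM, stmt, TM2.stepAux]
  | push k b S =>
    refine ⟨v, leads_one ?_⟩
    have hk : k ≤ N := hN
    simp only [TM2.step, hM, stmt, TM2.stepAux, restrict_ofNat hk, update_restrict hk]
  | seq _ _ ih ih' =>
    simp only [maxStack, max_le_iff] at hN
    obtain ⟨v₁, h₁⟩ := ih hN.1 (emb := fun l => emb (Sum.inl l)) (fun l => hM _) v
    obtain ⟨v₂, h₂⟩ := ih' hN.2 (emb := fun l => emb (Sum.inr l)) (fun l => hM _) v₁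
    exact ⟨v₂, h₁.trans h₂⟩
  | @caseTrue k a b e S S' t l hS _ ih =>
    simp only [maxStack, max_le_iff] at hN
    have h₀ := leads_popJump hN.1.1 (hM none) v S
    rw [hS] at h₀
    obtain ⟨v₁, h₁⟩ := ih hN.1.2 (emb := fun l => emb (some (Sum.inl l))) (fun l => hM _) (some true)
    exact ⟨v₁, h₀.trans h₁⟩
  | @caseFalse k a b e S S' t l hS _ ih =>
    simp only [maxStack, max_le_iff] at hN
    have h₀ := leads_popJump hN.1.1 (hM none) v S
    rw [hS] at h₀
    obtain ⟨v₁, h₁⟩ :=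
      ih hN.2.1 (emb := fun l => emb (some (Sum.inr (Sum.inl l)))) (fun l => hM _) (some false)
    exact ⟨v₁, h₀.trans h₁⟩
  | @caseNone k a b e S S' t hS _ ih =>
    simp only [maxStack, max_le_iff] at hN
    have h₀ := leads_popJump hN.1.1 (hM none) v S
    rw [hS, List.tail_nil, ← hS, update_eq_self] at h₀
    obtain ⟨v₁, h₁⟩ :=
      ih hN.2.2 (emb := fun l => emb (some (Sum.inr (Sum.inr l)))) (fun l => hM _) none
    rw [hS] at h₀
    exact ⟨v₁, h₀.trans h₁⟩
  | @loopTrue k a b S S' S'' t t' l hS _ _ ih ih' =>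
    have hN' := hN
    simp only [maxStack, max_le_iff] at hN
    have h₀ := leads_popJump hN.1 (hM none) v S
    rw [hS] at h₀
    obtain ⟨v₁, h₁⟩ := ih hN.2.1 (emb := fun l => emb (some (Sum.inl l))) (fun l => hM _) (some true)
    obtain ⟨v₂, h₂⟩ := ih' hN' hM v₁
    exact ⟨v₂, (h₀.trans h₁).trans h₂⟩
  | @loopFalse k a b S S' S'' t t' l hS _ _ ih ih' =>
    have hN' := hN
    simp only [maxStack, max_le_iff] at hN
    have h₀ := leads_popJump hN.1 (hM none) v S
    rw [hS] at h₀
    obtain ⟨v₁, h₁⟩ := ih hN.2.2 (emb := fun l => emb (some (Sum.inr l))) (fun l => hM _) (some false)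
    obtain ⟨v₂, h₂⟩ := ih' hN' hM v₁
    exact ⟨v₂, (h₀.trans h₁).trans h₂⟩
  | @loopNone k a b S hS =>
    simp only [maxStack, max_le_iff] at hN
    have h₀ := leads_popJump hN.1 (hM none) v S
    rw [hS, List.tail_nil, ← hS, update_eq_self] at h₀
    rw [hS] at h₀
    exact ⟨none, h₀⟩

/-- The Turing machine that executes a program, with input on the stack `0` and output on the
stack `1`. -/
noncomputable def machine (c : StackProg) : FinTM2 where
  K := Fin (max c.maxStack 1 + 1)
  k₀ := Fin.ofNat _ 0
  k₁ := Fin.ofNat _ 1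
  Γ _ := Bool
  Λ := Option c.Label
  main := some c.entry
  ΛFin := Fintype.ofFinite _
  σ := Option Bool
  initialState := none
  Γk₀Fin := inferInstanceAs (Fintype Bool)
  m l := l.elim (.load (fun _ => none) .halt) (c.stmt some none)

/-- A function is computable in polynomial time if a program that takes the encoded argument from
the stack `0` and leaves the encoded value on the stack `1`, all other stacks being empty, does so
in polynomially many steps. -/
theorem computableInPolyTime (c : StackProg) {α β : Type} {ea : α → List Bool}
    {eb : β → List Bool} {f : α → β} (P : Polynomial ℕ)
    (h : ∀ a, ∃ t ≤ P.eval (ea a).length,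
      Runs c (update (fun _ => []) 0 (ea a)) (update (fun _ => []) 1 (eb (f a))) t) :
    Nonempty (TM2ComputableInPolyTime ea eb f) := by
  choose t ht hrun using h
  refine ⟨⟨⟨c.machine, Equiv.refl _, Equiv.refl _⟩, P + 1, fun a => ?_⟩⟩
  refine ⟨⟨t a + 1, ?_⟩, by simpa using ht a⟩
  obtain ⟨v, hv⟩ := (hrun a).leads (M := c.machine.m) (le_max_left c.maxStack 1) (emb := some)
    (exit := none) (fun l => rfl) none
  -- The one extra step: at the label `none` the machine resets the remembered bit, as the halting
  -- configuration requires, and halts.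
  have hlast : Leads c.machine.m 1
      ⟨some none, v, restrict (max c.maxStack 1) (update (fun _ => []) 1 (eb (f a)))⟩
      ⟨none, none, restrict (max c.maxStack 1) (update (fun _ => []) 1 (eb (f a)))⟩ := rfl
  have hinit : initList c.machine ((ea a).map (Equiv.refl Bool).invFun) =
      ⟨some (some c.entry), none, restrict (max c.maxStack 1) (update (fun _ => []) 0 (ea a))⟩ := by
    unfold initList
    congr 1
    funext k
    by_cases hk : k = Fin.ofNat (max c.maxStack 1 + 1) 0
    · subst hk
      exact (dif_pos rfl).trans ((List.map_id _).trans (restrict_update_self (Nat.zero_le _) _).symm)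
    · exact (dif_neg hk).trans (restrict_update_of_ne (Nat.zero_le _) _ hk).symm
  have hhalt : haltList c.machine ((eb (f a)).map (Equiv.refl Bool).invFun) =
      ⟨none, none, restrict (max c.maxStack 1) (update (fun _ => []) 1 (eb (f a)))⟩ := by
    unfold haltList
    congr 1
    funext k
    by_cases hk : k = Fin.ofNat (max c.maxStack 1 + 1) 1
    · subst hk
      exact (dif_pos rfl).trans ((List.map_id _).trans (restrict_update_self (le_max_right _ _) _).symm)
    · exact (dif_neg hk).trans (restrict_update_of_ne (le_max_right _ _) _ hk).symm
  exact (congrArg (fun x => (flip bind c.machine.step)^[t a + 1] (some x)) hinit).trans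
    (Eq.trans (hv.trans hlast) (congrArg some hhalt.symm))

end StackProg

/-! ### Loop rule and elementary programs. -/

namespace StackProg

open Function

/-- The invariant is given explicitly: `st j` are the stacks after `j` iterations. Each iteration
costs one pop in addition to the body, and the last pop, on the empty stack, costs one step. -/
theorem runs_loop {k : ℕ} {a b : StackProg} {τ : ℕ} (l : List Bool) (st : ℕ → ℕ → List Bool)
    (hk : ∀ j ≤ l.length, st j k = l.drop j)
    (hb : ∀ j (hj : j < l.length), ∃ t ≤ τ,
      Runs (cond l[j] a b) (update (st j) k (l.drop (j + 1))) (st (j + 1)) t) :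
    ∃ T ≤ l.length * (τ + 1) + 1, Runs (loop k a b) (st 0) (st l.length) T := by
  induction l generalizing st with
  | nil => exact ⟨1, by simp, .loopNone (by simpa using hk 0)⟩
  | cons x l ih =>
    obtain ⟨t, ht, hrun⟩ := hb 0 (by simp)
    obtain ⟨T, hT, hrun'⟩ := ih (fun j => st (j + 1))
      (fun j hj => by simpa using hk (j + 1) (by simpa using hj))
      (fun j hj => by
        simpa only [List.getElem_cons_succ, List.drop_succ_cons] using
          hb (j + 1) (Nat.succ_lt_succ hj))
    have h0 : st 0 k = x :: l := by simpa using hk 0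
    refine ⟨1 + t + T, ?_, ?_⟩
    · simp only [List.length_cons]
      linarith [Nat.succ_mul l.length (τ + 1)]
    · cases x with
      | true => exact .loopTrue h0 (by simpa using hrun) hrun'
      | false => exact .loopFalse h0 (by simpa using hrun) hrun'

/-- Remove all bits from a stack. -/
def clear (k : ℕ) : StackProg := loop k skip skip

theorem runs_clear (k : ℕ) (S : ℕ → List Bool) :
    ∃ T ≤ (S k).length * 2 + 1, Runs (clear k) S (update S k []) T := by
  obtain ⟨T, hT, h⟩ := runs_loop (k := k) (a := skip) (b := skip) (τ := 1) (S k)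
    (fun j => update S k ((S k).drop j)) (fun j _ => update_self _ _ _)
    (fun j hj => ⟨1, le_rfl, by simpa using Runs.skip _⟩)
  exact ⟨T, hT, h.congr (by simp) (by simp)⟩

/-- Move all bits from the stack `k` to the stack `l`, reversing their order. -/
def move (k l : ℕ) : StackProg := loop k (push l true) (push l false)

theorem runs_move {k l : ℕ} (hkl : k ≠ l) (S : ℕ → List Bool) :
    ∃ T ≤ (S k).length * 2 + 1,
      Runs (move k l) S (update (update S k []) l ((S k).reverse ++ S l)) T := by
  obtain ⟨T, hT, h⟩ := runs_loop (k := k) (a := push l true) (b := push l false) (τ := 1) (S k)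
    (fun j => update (update S k ((S k).drop j)) l (((S k).take j).reverse ++ S l))
    (fun j _ => by rw [update_of_ne hkl, update_self])
    (fun j hj => by
      refine ⟨1, le_rfl, ?_⟩
      have : cond (S k)[j] (push l true) (push l false) = push l (S k)[j] := by
        cases (S k)[j] <;> rfl
      rw [this]
      refine (Runs.push _ _ _).congr rfl ?_
      have ht : ((S k).take (j + 1)).reverse = (S k)[j] :: ((S k).take j).reverse := by
        rw [← List.take_concat_get' _ _ hj]
        simp
      funext i
      simp only [ht, Function.update_apply]
      split_ifs <;> simp_all)
  exact ⟨T, hT, h.congr (by simp) (by simp)⟩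

theorem runs_pop (k : ℕ) (S : ℕ → List Bool) :
    Runs (case k skip skip skip) S (update S k (S k).tail) 2 := by
  rcases h : S k with _ | ⟨_ | _, l⟩
  · exact (Runs.caseNone h (.skip _)).congr rfl (by rw [List.tail_nil, ← h, update_eq_self])
  · exact .caseFalse h (.skip _)
  · exact .caseTrue h (.skip _)

end StackProg

/-! ### Terms that denote words computable in polynomial time -/

/-- Add a value in front of an environment. -/
def envCons (i : ℕ) (e : ℕ → ℕ) : ℕ → ℕ
  | 0 => i
  | k + 1 => e k

/-- Terms that denote words depending on an input word and on variables with values in `ℕ`; a number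
is represented by any word of this length. -/
inductive WordTerm
  | nil : WordTerm
  | bit : Bool → WordTerm
  | append : WordTerm → WordTerm → WordTerm
  /-- the concatenation of the words denoted by the second term when the variable `0` takes all
  values below the number denoted by the first term -/
  | bind : WordTerm → WordTerm → WordTerm
  /-- truncated difference -/
  | monus : WordTerm → WordTerm → WordTerm
  | var : ℕ → WordTerm
  /-- `1` if the bit of the input at the given position exists and is `true` -/
  | lookup : WordTerm → WordTerm
  /-- the length of the input -/
  | len : WordTerm

namespace WordTerm

open Function StackProg

/-- The word that a term denotes. -/
def val : WordTerm → List Bool → (ℕ → ℕ) → List Bool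
  | nil, _, _ => []
  | bit b, _, _ => [b]
  | append p q, x, e => p.val x e ++ q.val x e
  | bind p q, x, e => (List.range (p.val x e).length).flatMap fun i => q.val x (envCons i e)
  | monus p q, x, e => List.replicate ((p.val x e).length - (q.val x e).length) true
  | var i, _, e => List.replicate (e i) true
  | lookup p, x, e => if x[(p.val x e).length]? = some true then [true] else []
  | len, x, _ => List.replicate x.length true

/-- The program that pushes the word denoted by a term onto the stack `r`, if the input is on the
stack `0`, the variables are on the stacks given by `ρ`, and the stacks from `f` on are free. -/
def prog : WordTerm → (ℕ → ℕ) → ℕ → ℕ → StackProg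
  | nil, _, _, _ => .skip
  | bit b, _, r, _ => .push r b
  | append p q, ρ, r, f => .seq (p.prog ρ r f) (q.prog ρ r f)
  | bind p q, ρ, r, f =>
    let body := .seq (q.prog (envCons (f + 1) ρ) r (f + 2)) (.push (f + 1) true)
    .seq (p.prog ρ f (f + 1)) (.seq (.loop f body body) (clear (f + 1)))
  | monus p q, ρ, r, f =>
    let body := .case f .skip .skip .skip
    .seq (p.prog ρ f (f + 1)) (.seq (q.prog ρ (f + 1) (f + 2))
      (.seq (.loop (f + 1) body body) (.loop f (.push r true) (.push r true))))
  | var i, ρ, r, f =>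
    let body := .seq (.push (ρ i) true) (.push r true)
    .seq (move (ρ i) f) (.loop f body body)
  | lookup p, ρ, r, f =>
    let body := .case 0 (.push (f + 1) true) (.push (f + 1) false) .skip
    .seq (p.prog ρ f (f + 1)) (.seq (.loop f body body)
      (.seq (.case 0 (.seq (.push 0 true) (.push r true)) (.push 0 false) .skip) (move (f + 1) 0)))
  | len, _, r, f =>
    .seq (.loop 0 (.seq (.push f true) (.push r true)) (.seq (.push f false) (.push r true)))
      (move f 0)

/-- The stacks `S` represent the input `x` and the environment `e`, and the stack `r` is a possible
target. -/
structure Represents (S : ℕ → List Bool) (x : List Bool) (e ρ : ℕ → ℕ) (r f : ℕ) : Prop where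
  input : S 0 = x
  var : ∀ i, S (ρ i) = List.replicate (e i) true
  free : ∀ k, f ≤ k → S k = []
  var_lt : ∀ i, ρ i < f
  var_ne_zero : ∀ i, ρ i ≠ 0
  target_lt : r < f
  target_ne_zero : r ≠ 0
  target_ne_var : ∀ i, ρ i ≠ r

variable {S : ℕ → List Bool} {x : List Bool} {e ρ : ℕ → ℕ} {r f : ℕ}

theorem Represents.update_target (h : Represents S x e ρ r f) (l : List Bool) :
    Represents (update S r l) x e ρ r f where
  input := by rw [update_of_ne h.target_ne_zero.symm, h.input]
  var i := by rw [update_of_ne (h.target_ne_var i), h.var]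
  free k hk := by rw [update_of_ne (by have := h.target_lt; omega), h.free k hk]
  var_lt := h.var_lt
  var_ne_zero := h.var_ne_zero
  target_lt := h.target_lt
  target_ne_zero := h.target_ne_zero
  target_ne_var := h.target_ne_var

theorem Represents.fresh_target (h : Represents S x e ρ r f) : Represents S x e ρ f (f + 1) where
  input := h.input
  var := h.var
  free k hk := h.free k (by omega)
  var_lt i := (h.var_lt i).trans (Nat.lt_succ_self f)
  var_ne_zero := h.var_ne_zero
  target_lt := Nat.lt_succ_self f
  target_ne_zero := by have := h.target_lt; omega
  target_ne_var i := (h.var_lt i).ne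

/-- The situation inside the loop of a `bind`: stack `f` holds what remains of the loop counter,
stack `f + 1` the bound variable. -/
theorem Represents.envCons (h : Represents S x e ρ r f) (l : List Bool) (i : ℕ) :
    Represents (update (update S f l) (f + 1) (List.replicate i true)) x (envCons i e)
      (envCons (f + 1) ρ) r (f + 2) where
  input := by
    have := h.target_lt
    rw [update_of_ne (by omega), update_of_ne (by omega), h.input]
  var
    | 0 => by simp [_root_.envCons]
    | j + 1 => by
      have := h.var_lt j
      simp only [_root_.envCons]
      rw [update_of_ne (by omega), update_of_ne (by omega), h.var]
  free k hk := by rw [update_of_ne (by omega), update_of_ne (by omega), h.free k (by omega)]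
  var_lt
    | 0 => by simp [_root_.envCons]
    | j + 1 => by have := h.var_lt j; simp only [_root_.envCons]; omega
  var_ne_zero
    | 0 => by simp [_root_.envCons]
    | j + 1 => h.var_ne_zero j
  target_lt := by have := h.target_lt; omega
  target_ne_zero := h.target_ne_zero
  target_ne_var
    | 0 => by have := h.target_lt; simp only [_root_.envCons]; omega
    | j + 1 => h.target_ne_var j

/-- The polynomial bounds the length and the time of computation of the word denoted by a term, in
terms of a bound for the length of the input and the values of the variables. -/
def BoundedBy (t : WordTerm) (P : Polynomial ℕ) : Prop :=
  ∀ S x e ρ r f B, x.length ≤ B → (∀ i, e i ≤ B) → Represents S x e ρ r f →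
    (t.val x e).length ≤ P.eval B ∧ ∃ T ≤ P.eval B,
      Runs (t.prog ρ r f) S (update S r ((t.val x e).reverse ++ S r)) T

theorem boundedBy_append {p q : WordTerm} {P Q : Polynomial ℕ} (hp : BoundedBy p P)
    (hq : BoundedBy q Q) : BoundedBy (append p q) (P + Q) := by
  intro S x e ρ r f B hx he h
  obtain ⟨h1, T, hT, hr⟩ := hp S x e ρ r f B hx he h
  obtain ⟨h1', T', hT', hr'⟩ := hq _ x e ρ r f B hx he (h.update_target ((p.val x e).reverse ++ S r))
  simp only [Polynomial.eval_add]
  refine ⟨by simp only [val, List.length_append]; omega, T + T', by omega,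
    (hr.seq hr').congr rfl ?_⟩
  simp [val]

/-- There are at most `P` iterations. The bound variable can be as large as `P`, so the body is
charged `Q` at `X + P`, plus its increment and the pop; clearing the bound variable accounts for the
last summand. -/
theorem boundedBy_bind {p q : WordTerm} {P Q : Polynomial ℕ} (hp : BoundedBy p P)
    (hq : BoundedBy q Q) :
    BoundedBy (bind p q) (P + P * (Q.comp (Polynomial.X + P) + 2) + 2 + P * 2) := by
  intro S x e ρ r f B hx he h
  obtain ⟨h1, T, hT, hr⟩ := hp S x e ρ f (f + 1) B hx he h.fresh_target
  have hf : S f = [] := h.free f le_rfl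
  have hf1 : S (f + 1) = [] := h.free (f + 1) (by omega)
  have hrf := h.target_lt
  simp only [Polynomial.eval_add, Polynomial.eval_mul, Polynomial.eval_comp, Polynomial.eval_X,
    Polynomial.eval_ofNat]
  set l := (p.val x e).reverse with hl
  have hll : l.length = (p.val x e).length := by simp [hl]
  set B' := B + P.eval B with hB'
  set out : ℕ → List Bool :=
    fun j => ((List.range j).flatMap fun i => q.val x (envCons i e)) with hout
  have hout1 : ∀ j, out (j + 1) = out j ++ q.val x (envCons j e) := by
    intro j; simp [hout, List.range_succ]
  have hE : ∀ i, i ≤ P.eval B → ∀ k, envCons i e k ≤ B' := by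
    intro i hi k
    cases k with
    | zero => simp only [envCons]; omega
    | succ k => have := he k; simp only [envCons]; omega
  have hlen : ∀ j ≤ l.length, (out j).length ≤ j * Q.eval B' := by
    intro j
    induction j with
    | zero => intro _; simp [hout]
    | succ j ih =>
      intro hj
      have := (hq _ x _ _ _ _ B' (by omega) (hE j (by omega)) (h.envCons [] j)).1
      rw [hout1, List.length_append, Nat.succ_mul]
      have := ih (by omega)
      omega
  obtain ⟨T', hT', hr'⟩ := runs_loop (k := f)
    (a := .seq (q.prog (envCons (f + 1) ρ) r (f + 2)) (.push (f + 1) true))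
    (b := .seq (q.prog (envCons (f + 1) ρ) r (f + 2)) (.push (f + 1) true))
    (τ := Q.eval B' + 1) l
    (fun j => update (update (update S f (l.drop j)) (f + 1) (List.replicate j true)) r
      ((out j).reverse ++ S r))
    (fun j _ => by rw [update_of_ne (by omega), update_of_ne (by omega), update_self])
    (fun j hj => by
      obtain ⟨-, t, ht, hrun⟩ := hq _ x _ _ _ _ B' (by omega) (hE j (by omega))
        ((h.envCons (l.drop (j + 1)) j).update_target ((out j).reverse ++ S r))
      refine ⟨t + 1, by omega, ?_⟩
      rw [Bool.cond_self]
      refine (hrun.seq (.push _ _ _)).congr ?_ ?_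
      · funext i
        simp only [Function.update_apply]
        split_ifs <;> first | omega | rfl
      · funext i
        simp only [Function.update_apply, hout1, List.reverse_append, List.append_assoc,
          List.replicate_succ]
        split_ifs <;> first | omega | rfl)
  obtain ⟨T'', hT'', hr''⟩ := runs_clear (f + 1) (update (update (update S f (l.drop l.length))
    (f + 1) (List.replicate l.length true)) r ((out l.length).reverse ++ S r))
  rw [update_of_ne (by omega), update_self, List.length_replicate] at hT''
  have hlP : l.length ≤ P.eval B := by omega
  have hm1 : l.length * Q.eval B' ≤ P.eval B * Q.eval B' := Nat.mul_le_mul_right _ hlP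
  have hm2 : l.length * (Q.eval B' + 1 + 1) ≤ P.eval B * (Q.eval B' + 2) :=
    Nat.mul_le_mul_right _ hlP
  refine ⟨?_, T + (T' + T''), by omega, (hr.seq (Runs.seq (hr'.congr ?_ rfl) hr'')).congr rfl ?_⟩
  · have := hlen l.length le_rfl
    simp only [hout, hll] at this
    rw [hll] at hm1
    simp only [val]
    rw [Nat.mul_add]
    omega
  · funext i
    simp only [Function.update_apply, hf, List.append_nil]
    split_ifs <;> simp_all
  · funext i
    simp only [Function.update_apply, hll, val]
    split_ifs <;> simp_all

/-- Every bit of the second word pops one bit of the first. Popping an empty stack has no effect,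
which is the truncation. -/
theorem boundedBy_monus {p q : WordTerm} {P Q : Polynomial ℕ} (hp : BoundedBy p P)
    (hq : BoundedBy q Q) : BoundedBy (monus p q) (P + Q + (Q * 3 + 1) + (P * 2 + 1)) := by
  intro S x e ρ r f B hx he h
  obtain ⟨h1, T, hT, hr⟩ := hp S x e ρ f (f + 1) B hx he h.fresh_target
  obtain ⟨h1', T', hT', hr'⟩ := hq _ x e ρ (f + 1) (f + 2) B hx he
    (h.fresh_target.update_target ((p.val x e).reverse ++ S f)).fresh_target
  have hf : S f = [] := h.free f le_rfl
  have hf1 : S (f + 1) = [] := h.free (f + 1) (by omega)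
  have hrf := h.target_lt
  simp only [Polynomial.eval_add, Polynomial.eval_mul, Polynomial.eval_ofNat, Polynomial.eval_one]
  set lp := (p.val x e).reverse with hlp
  set lq := (q.val x e).reverse with hlq
  have hp' : lp.length = (p.val x e).length := by simp [hlp]
  have hq' : lq.length = (q.val x e).length := by simp [hlq]
  obtain ⟨T₁, hT₁, hr₁⟩ := runs_loop (k := f + 1) (a := .case f .skip .skip .skip)
    (b := .case f .skip .skip .skip) (τ := 2) lq
    (fun j => update (update S f (lp.drop j)) (f + 1) (lq.drop j))
    (fun j _ => update_self _ _ _)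
    (fun j hj => ⟨2, le_rfl, by
      rw [Bool.cond_self]
      refine (runs_pop f _).congr rfl ?_
      funext i
      simp only [Function.update_apply]
      split_ifs <;> first | omega | simp⟩)
  set l := lp.drop lq.length with hl
  have hl' : l.length = lp.length - lq.length := by simp [hl]
  obtain ⟨T₂, hT₂, hr₂⟩ := runs_loop (k := f) (a := .push r true) (b := .push r true) (τ := 1) l
    (fun j => update (update S f (l.drop j)) r (List.replicate j true ++ S r))
    (fun j _ => by rw [update_of_ne (by omega), update_self])
    (fun j hj => ⟨1, le_rfl, by
      rw [Bool.cond_self]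
      refine (Runs.push _ _ _).congr rfl ?_
      funext i
      simp only [Function.update_apply, List.replicate_succ]
      split_ifs <;> first | omega | simp⟩)
  refine ⟨by simp only [val, List.length_replicate]; omega, T + (T' + (T₁ + T₂)), by omega,
    (hr.seq (hr'.seq ((hr₁.congr ?_ rfl).seq (hr₂.congr ?_ rfl)))).congr rfl ?_⟩
  · funext i
    simp only [Function.update_apply, hf, hf1]
    split_ifs <;> simp_all
  · funext i
    simp only [Function.update_apply]
    split_ifs <;> simp_all
  · funext i
    simp only [Function.update_apply, val, List.reverse_replicate, hl', hp', hq']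
    split_ifs <;> simp_all
    omega

/-- Reading a stack destroys it, so the variable is moved to a free stack and restored while it is
copied to the target. -/
theorem boundedBy_var (i : ℕ) :
    BoundedBy (var i) (Polynomial.X * 2 + 1 + (Polynomial.X * 3 + 1)) := by
  intro S x e ρ r f B hx he h
  have hrf := h.target_lt
  have hf : S f = [] := h.free f le_rfl
  have hi := h.var_lt i
  have hir := h.target_ne_var i
  have hei := he i
  have hSi := h.var i
  simp only [Polynomial.eval_add, Polynomial.eval_mul, Polynomial.eval_ofNat, Polynomial.eval_one,
    Polynomial.eval_X]
  obtain ⟨T₁, hT₁, hr₁⟩ := runs_move (k := ρ i) (l := f) (by omega) S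
  rw [hSi, List.reverse_replicate] at hr₁
  rw [hSi, List.length_replicate] at hT₁
  obtain ⟨T₂, hT₂, hr₂⟩ := runs_loop (k := f) (a := .seq (.push (ρ i) true) (.push r true))
    (b := .seq (.push (ρ i) true) (.push r true)) (τ := 2) (List.replicate (e i) true)
    (fun j => update (update (update S f ((List.replicate (e i) true).drop j)) r
      (List.replicate j true ++ S r)) (ρ i) (List.replicate j true))
    (fun j _ => by rw [update_of_ne (by omega), update_of_ne (by omega), update_self])
    (fun j hj => ⟨2, le_rfl, by
      rw [Bool.cond_self]
      refine ((Runs.push _ _ _).seq (.push _ _ _)).congr rfl ?_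
      funext i
      simp only [Function.update_apply, List.replicate_succ]
      split_ifs <;> first | omega | simp⟩)
  rw [List.length_replicate] at hT₂
  refine ⟨by simp only [val, List.length_replicate]; omega, T₁ + T₂, by omega,
    (hr₁.seq (hr₂.congr ?_ rfl)).congr rfl ?_⟩
  · funext k
    simp only [Function.update_apply]
    split_ifs <;> simp_all
  · funext k
    simp only [Function.update_apply, val, List.reverse_replicate]
    split_ifs <;> simp_all

theorem boundedBy_len :
    BoundedBy len (Polynomial.X * 3 + 1 + (Polynomial.X * 2 + 1)) := by
  intro S x e ρ r f B hx he h
  have hrf := h.target_lt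
  have hf : S f = [] := h.free f le_rfl
  have hr0 := h.target_ne_zero
  have hS0 := h.input
  simp only [Polynomial.eval_add, Polynomial.eval_mul, Polynomial.eval_ofNat, Polynomial.eval_one,
    Polynomial.eval_X]
  obtain ⟨T₁, hT₁, hr₁⟩ := runs_loop (k := 0) (a := .seq (.push f true) (.push r true))
    (b := .seq (.push f false) (.push r true)) (τ := 2) x
    (fun j => update (update (update S 0 (x.drop j)) r (List.replicate j true ++ S r)) f
      (x.take j).reverse)
    (fun j _ => by rw [update_of_ne (by omega), update_of_ne (by omega), update_self])
    (fun j hj => ⟨2, le_rfl, by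
      have : cond x[j] (StackProg.seq (.push f true) (.push r true))
          (.seq (.push f false) (.push r true)) = .seq (.push f x[j]) (.push r true) := by
        cases x[j] <;> rfl
      rw [this]
      have ht : (x.take (j + 1)).reverse = x[j] :: (x.take j).reverse := by
        rw [← List.take_concat_get' _ _ hj]
        simp
      refine ((Runs.push _ _ _).seq (.push _ _ _)).congr rfl ?_
      funext i
      simp only [Function.update_apply, List.replicate_succ, ht]
      split_ifs <;> first | omega | simp⟩)
  obtain ⟨T₂, hT₂, hr₂⟩ := runs_move (k := f) (l := 0) (by omega) (update (update (update S 0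
    (x.drop x.length)) r (List.replicate x.length true ++ S r)) f (x.take x.length).reverse)
  rw [update_self, List.length_reverse, List.take_length] at hT₂
  refine ⟨by simp only [val, List.length_replicate]; omega, T₁ + T₂, by omega,
    ((hr₁.congr ?_ rfl).seq hr₂).congr rfl ?_⟩
  · funext k
    simp only [Function.update_apply]
    split_ifs <;> simp_all
  · funext k
    simp only [Function.update_apply, val, List.reverse_replicate]
    split_ifs <;> simp_all

/-- The input is shifted to a free stack up to the required position, the top bit is inspected and
put back, and the shifted bits are returned. If the input is exhausted earlier, the remaining pops
do nothing. -/
theorem boundedBy_lookup {p : WordTerm} {P : Polynomial ℕ} (hp : BoundedBy p P) :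
    BoundedBy (lookup p) (P + (P * 3 + 1) + 3 + (P * 2 + 1)) := by
  intro S x e ρ r f B hx he h
  obtain ⟨h1, T, hT, hr⟩ := hp S x e ρ f (f + 1) B hx he h.fresh_target
  have hf : S f = [] := h.free f le_rfl
  have hf1 : S (f + 1) = [] := h.free (f + 1) (by omega)
  have hrf := h.target_lt
  have hr0 := h.target_ne_zero
  have hS0 := h.input
  simp only [Polynomial.eval_add, Polynomial.eval_mul, Polynomial.eval_ofNat, Polynomial.eval_one]
  have hf0 : 0 ≠ f := by omega
  set l := (p.val x e).reverse with hl
  have hl' : l.length = (p.val x e).length := by simp [hl]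
  obtain ⟨T₁, hT₁, hr₁⟩ := runs_loop (k := f)
    (a := .case 0 (.push (f + 1) true) (.push (f + 1) false) .skip)
    (b := .case 0 (.push (f + 1) true) (.push (f + 1) false) .skip) (τ := 2) l
    (fun j => update (update (update S f (l.drop j)) (f + 1) (x.take j).reverse) 0 (x.drop j))
    (fun j _ => by rw [update_of_ne (by omega), update_of_ne (by omega), update_self])
    (fun j _ => ⟨2, le_rfl, by
      rw [Bool.cond_self]
      by_cases hj : j < x.length
      · have ht : (x.take (j + 1)).reverse = x[j] :: (x.take j).reverse := by
          rw [← List.take_concat_get' _ _ hj]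
          simp
        have hd : x.drop j = x[j] :: x.drop (j + 1) := List.drop_eq_getElem_cons hj
        rcases hb : x[j] with _ | _
        · refine (Runs.caseFalse (l := x.drop (j + 1)) 
            (by simp [hd, hb, update_of_ne hf0]) (.push _ _ _)).congr rfl ?_
          funext i
          simp only [Function.update_apply, ht, hb]
          split_ifs <;> first | omega | contradiction | simp
        · refine (Runs.caseTrue (l := x.drop (j + 1)) 
            (by simp [hd, hb, update_of_ne hf0]) (.push _ _ _)).congr rfl ?_
          funext i
          simp only [Function.update_apply, ht, hb]
          split_ifs <;> first | omega | contradiction | simp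
      · have hd : x.drop j = [] := List.drop_eq_nil_of_le (by omega)
        have hd' : x.drop (j + 1) = [] := List.drop_eq_nil_of_le (by omega)
        have ht : x.take j = x := List.take_of_length_le (by omega)
        have ht' : x.take (j + 1) = x := List.take_of_length_le (by omega)
        refine (Runs.caseNone (by simp [hd, update_of_ne hf0]) (.skip _)).congr rfl ?_
        funext i
        simp only [Function.update_apply, ht, ht', hd, hd']
        split_ifs <;> first | omega | simp⟩)
  set n := l.length with hn
  obtain ⟨T₂, hT₂, hr₂⟩ : ∃ T₂ ≤ 3, Runs
      (.case 0 (.seq (.push 0 true) (.push r true)) (.push 0 false) .skip)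
      (update (update (update S f (l.drop n)) (f + 1) (x.take n).reverse) 0 (x.drop n))
      (update (update (update S (f + 1) (x.take n).reverse) 0 (x.drop n)) r
        (((lookup p).val x e).reverse ++ S r)) T₂ := by
    by_cases hj : n < x.length
    · have hd : x.drop n = x[n] :: x.drop (n + 1) := List.drop_eq_getElem_cons hj
      have hg : x[(p.val x e).length]? = some x[n] := by
        rw [← hl']; exact List.getElem?_eq_getElem hj
      rcases hb : x[n] with _ | _
      · refine ⟨2, by omega, (Runs.caseFalse (l := x.drop (n + 1)) (by simp [hd, hb])
          (.push _ _ _)).congr rfl ?_⟩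
        funext i
        simp only [Function.update_apply, hd, hb, val, hg]
        split_ifs <;> simp_all
      · refine ⟨3, by omega, (Runs.caseTrue (l := x.drop (n + 1)) (by simp [hd, hb])
          ((Runs.push _ _ _).seq (.push _ _ _))).congr rfl ?_⟩
        funext i
        simp only [Function.update_apply, hd, hb, val, hg]
        split_ifs <;> simp_all
    · have hd : x.drop n = [] := List.drop_eq_nil_of_le (by omega)
      have hg : x[(p.val x e).length]? = none := by
        rw [← hl']; exact List.getElem?_eq_none (by omega)
      refine ⟨2, by omega, (Runs.caseNone (by simp [hd]) (.skip _)).congr rfl ?_⟩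
      funext i
      simp only [Function.update_apply, val, hg]
      split_ifs <;> simp_all
  obtain ⟨T₃, hT₃, hr₃⟩ := runs_move (k := f + 1) (l := 0) (by omega)
    (update (update (update S (f + 1) (x.take n).reverse) 0 (x.drop n)) r
        (((lookup p).val x e).reverse ++ S r))
  rw [update_of_ne (by omega), update_of_ne (by omega), update_self, List.length_reverse,
    List.length_take] at hT₃
  refine ⟨?_, T + (T₁ + (T₂ + T₃)), by omega,
    (hr.seq ((hr₁.congr ?_ rfl).seq (hr₂.seq hr₃))).congr rfl ?_⟩
  · simp only [val]
    split_ifs <;> simp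
    omega
  · funext i
    simp only [Function.update_apply, hf]
    split_ifs <;> simp_all
  · funext i
    simp only [Function.update_apply]
    split_ifs <;> first | omega | simp_all

theorem exists_boundedBy (t : WordTerm) : ∃ P, BoundedBy t P := by
  induction t with
  | nil => exact ⟨1, fun S x e ρ r f B _ _ _ => ⟨by simp [val], 1, by simp,
      (Runs.skip S).congr rfl (by simp [val])⟩⟩
  | bit b => exact ⟨1, fun S x e ρ r f B _ _ _ => ⟨by simp [val], 1, by simp,
      (Runs.push _ _ S).congr rfl (by simp [val])⟩⟩
  | append p q hp hq => exact ⟨_, boundedBy_append hp.choose_spec hq.choose_spec⟩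
  | bind p q hp hq => exact ⟨_, boundedBy_bind hp.choose_spec hq.choose_spec⟩
  | monus p q hp hq => exact ⟨_, boundedBy_monus hp.choose_spec hq.choose_spec⟩
  | var i => exact ⟨_, boundedBy_var i⟩
  | lookup p hp => exact ⟨_, boundedBy_lookup hp.choose_spec⟩
  | len => exact ⟨_, boundedBy_len⟩

/-- A function is computable in polynomial time if its encoded value is denoted by a term. -/
theorem computableInPolyTime (t : WordTerm) {α β : Type} {ea : α → List Bool}
    {eb : β → List Bool} {f : α → β} (h : ∀ a, t.val (ea a) (fun _ => 0) = eb (f a)) :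
    Nonempty (Turing.TM2ComputableInPolyTime ea eb f) := by
  obtain ⟨P, hP⟩ := t.exists_boundedBy
  -- All variables share the empty stack 2, which represents the value 0. The result arises in
  -- reverse on stack 3; moving it to stack 1 restores its order.
  refine StackProg.computableInPolyTime
    (.seq (t.prog (fun _ => 2) 3 4) (.seq (clear 0) (move 3 1)))
    (P + (Polynomial.X * 2 + 1 + (P * 2 + 1))) fun a => ?_
  obtain ⟨h1, T, hT, hr⟩ := hP (update (fun _ => []) 0 (ea a)) (ea a) (fun _ => 0) (fun _ => 2) 3 4
    (ea a).length le_rfl (by simp)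
    ⟨by simp, by simp, fun k hk => by simp [show k ≠ 0 by omega], by simp, by simp, by simp,
      by simp, by simp⟩
  rw [h] at h1 hr
  obtain ⟨T₁, hT₁, hr₁⟩ := runs_clear 0 (update (update (fun _ => []) 0 (ea a)) 3
    ((eb (f a)).reverse ++ update (fun _ => []) 0 (ea a) 3))
  obtain ⟨T₂, hT₂, hr₂⟩ := runs_move (k := 3) (l := 1) (by omega) (update (update (update
    (fun _ => []) 0 (ea a)) 3 ((eb (f a)).reverse ++ update (fun _ => []) 0 (ea a) 3)) 0 [])
  simp only [Polynomial.eval_add, Polynomial.eval_mul, Polynomial.eval_ofNat, Polynomial.eval_one,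
    Polynomial.eval_X]
  simp at hT₁ hT₂
  refine ⟨T + (T₁ + T₂), by omega, (hr.seq (hr₁.seq hr₂)).congr rfl ?_⟩
  funext i
  simp only [Function.update_apply]
  split_ifs <;> simp_all

end WordTerm

namespace WordTerm

/-- Rename the variables of a term. -/
def rename : WordTerm → (ℕ → ℕ) → WordTerm
  | nil, _ => nil
  | bit b, _ => bit b
  | append p q, ρ => append (p.rename ρ) (q.rename ρ)
  | bind p q, ρ => bind (p.rename ρ) (q.rename (envCons 0 fun k => ρ k + 1))
  | monus p q, ρ => monus (p.rename ρ) (q.rename ρ)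
  | var i, ρ => var (ρ i)
  | lookup p, ρ => lookup (p.rename ρ)
  | len, _ => len

theorem val_rename (t : WordTerm) (ρ : ℕ → ℕ) (x : List Bool) (e : ℕ → ℕ) :
    (t.rename ρ).val x e = t.val x (fun k => e (ρ k)) := by
  induction t generalizing ρ e with
  | bind p q hp hq =>
    simp only [rename, val, hp, hq]
    have henv : ∀ i, (fun k => envCons i e (envCons 0 (fun k => ρ k + 1) k)) =
        envCons i fun k => e (ρ k) := fun i => by
      funext k
      cases k <;> rfl
    simp only [henv]
  | _ => simp_all [rename, val]

end WordTerm

/-! ### Closure properties of definable words, numbers and predicates. -/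

/-- The word depending on an input word and on variables is denoted by a term. -/
def IsWord (F : List Bool → (ℕ → ℕ) → List Bool) : Prop :=
  ∃ t : WordTerm, ∀ x e, t.val x e = F x e

/-- The number depending on an input word and on variables is denoted by a term. -/
def IsNum (g : List Bool → (ℕ → ℕ) → ℕ) : Prop :=
  ∃ t : WordTerm, ∀ x e, (t.val x e).length = g x e

/-- The property of an input word and of variables is decided by a term. -/
def IsPred (φ : List Bool → (ℕ → ℕ) → Prop) : Prop :=
  ∃ t : WordTerm, ∀ x e, ((t.val x e).length = 1 ∧ φ x e) ∨ ((t.val x e).length = 0 ∧ ¬ φ x e)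

section Closure

open WordTerm

variable {F G : List Bool → (ℕ → ℕ) → List Bool} {g h : List Bool → (ℕ → ℕ) → ℕ}
  {φ ψ : List Bool → (ℕ → ℕ) → Prop}

/-- For use under a binder, where variable 0 is the newly bound one. -/
theorem IsNum.wk (hg : IsNum g) : IsNum fun x e => g x fun k => e (k + 1) := by
  obtain ⟨t, ht⟩ := hg
  exact ⟨t.rename (· + 1), fun x e => by rw [val_rename, ht]⟩

theorem IsWord.wk (hF : IsWord F) : IsWord fun x e => F x fun k => e (k + 1) := by
  obtain ⟨t, ht⟩ := hF
  exact ⟨t.rename (· + 1), fun x e => by rw [val_rename, ht]⟩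

theorem IsNum.var (i : ℕ) : IsNum fun _ e => e i := ⟨.var i, fun x e => by simp [val]⟩

theorem IsNum.len : IsNum fun x _ => x.length := ⟨.len, fun x e => by simp [val]⟩

theorem IsNum.add (hg : IsNum g) (hh : IsNum h) : IsNum fun x e => g x e + h x e := by
  obtain ⟨t, ht⟩ := hg
  obtain ⟨s, hs⟩ := hh
  exact ⟨.append t s, fun x e => by simp [val, ht, hs]⟩

theorem IsNum.sub (hg : IsNum g) (hh : IsNum h) : IsNum fun x e => g x e - h x e := by
  obtain ⟨t, ht⟩ := hg
  obtain ⟨s, hs⟩ := hh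
  exact ⟨.monus t s, fun x e => by simp [val, ht, hs]⟩

theorem IsNum.const (n : ℕ) : IsNum fun _ _ => n := by
  induction n with
  | zero => exact ⟨.nil, fun x e => by simp [val]⟩
  | succ n ih => exact ih.add ⟨.bit true, fun x e => by simp [val]⟩

theorem IsNum.sum {b : List Bool → (ℕ → ℕ) → ℕ → ℕ} (hg : IsNum g)
    (hb : IsNum fun x e => b x (fun k => e (k + 1)) (e 0)) :
    IsNum fun x e => ∑ i ∈ Finset.range (g x e), b x e i := by
  obtain ⟨t, ht⟩ := hg
  obtain ⟨s, hs⟩ := hb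
  refine ⟨.bind t s, fun x e => ?_⟩
  simp only [val, List.length_flatMap, ht, hs]
  rfl

theorem IsNum.mul (hg : IsNum g) (hh : IsNum h) : IsNum fun x e => g x e * h x e := by
  have := IsNum.sum (b := fun x e _ => h x e) hg hh.wk
  simpa using this

theorem IsPred.not (hφ : IsPred φ) : IsPred fun x e => ¬ φ x e := by
  obtain ⟨t, ht⟩ := hφ
  refine ⟨.monus (.bit true) t, fun x e => ?_⟩
  rcases ht x e with ⟨h1, h2⟩ | ⟨h1, h2⟩ <;> simp [val, h1, h2]

/-- The double complement 1 - (1 - k) cuts a number k down to 0 or 1; the same device serves for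
`IsPred.lt` and `IsPred.exists_lt`. -/
theorem IsPred.or (hφ : IsPred φ) (hψ : IsPred ψ) : IsPred fun x e => φ x e ∨ ψ x e := by
  obtain ⟨t, ht⟩ := hφ
  obtain ⟨s, hs⟩ := hψ
  refine ⟨.monus (.bit true) (.monus (.bit true) (.append t s)), fun x e => ?_⟩
  rcases ht x e with ⟨h1, h2⟩ | ⟨h1, h2⟩ <;> rcases hs x e with ⟨h3, h4⟩ | ⟨h3, h4⟩ <;>
    simp [val, h1, h2, h3, h4]

theorem IsPred.and (hφ : IsPred φ) (hψ : IsPred ψ) : IsPred fun x e => φ x e ∧ ψ x e := by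
  simpa [not_or] using (hφ.not.or hψ.not).not

theorem IsPred.lt (hg : IsNum g) (hh : IsNum h) : IsPred fun x e => g x e < h x e := by
  obtain ⟨t, ht⟩ := hg
  obtain ⟨s, hs⟩ := hh
  refine ⟨.monus (.bit true) (.monus (.bit true) (.monus s t)), fun x e => ?_⟩
  simp only [val, List.length_replicate, List.length_singleton, ht, hs]
  omega

theorem IsPred.le (hg : IsNum g) (hh : IsNum h) : IsPred fun x e => g x e ≤ h x e := by
  simpa [not_lt] using (IsPred.lt hh hg).not

theorem IsPred.eq (hg : IsNum g) (hh : IsNum h) : IsPred fun x e => g x e = h x e := by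
  simpa [← le_antisymm_iff] using (IsPred.le hg hh).and (IsPred.le hh hg)

theorem IsPred.lookup (hg : IsNum g) : IsPred fun x e => x[g x e]? = some true := by
  obtain ⟨t, ht⟩ := hg
  refine ⟨.lookup t, fun x e => ?_⟩
  simp only [val, ht]
  split_ifs with h1 <;> simp [h1]

theorem IsPred.exists_lt {b : List Bool → (ℕ → ℕ) → ℕ → Prop} (hg : IsNum g)
    (hb : IsPred fun x e => b x (fun k => e (k + 1)) (e 0)) :
    IsPred fun x e => ∃ i < g x e, b x e i := by
  obtain ⟨t, ht⟩ := hg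
  obtain ⟨s, hs⟩ := hb
  refine ⟨.monus (.bit true) (.monus (.bit true) (.bind t s)), fun x e => ?_⟩
  have key : ((WordTerm.bind t s).val x e).length = 0 ↔ ¬ ∃ i < g x e, b x e i := by
    simp only [val, ht, List.length_eq_zero_iff, List.flatMap_eq_nil_iff, List.mem_range]
    push Not
    refine forall₂_congr fun i _ => ?_
    have : ((s.val x (envCons i e)).length = 1 ∧ b x e i) ∨
        ((s.val x (envCons i e)).length = 0 ∧ ¬ b x e i) := hs x (envCons i e)
    rw [← List.length_eq_zero_iff]
    rcases this with ⟨h1, h2⟩ | ⟨h1, h2⟩ <;> simp [h1, h2]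
  generalize WordTerm.bind t s = w at *
  simp only [val, List.length_replicate, List.length_singleton]
  by_cases hc : (w.val x e).length = 0
  · exact Or.inr ⟨by omega, key.1 hc⟩
  · exact Or.inl ⟨by omega, not_not.1 (fun hn => hc (key.2 hn))⟩

theorem IsNum.indicator [∀ x e, Decidable (φ x e)] (hφ : IsPred φ) :
    IsNum fun x e => if φ x e then 1 else 0 := by
  obtain ⟨t, ht⟩ := hφ
  refine ⟨t, fun x e => ?_⟩
  rcases ht x e with ⟨h1, h2⟩ | ⟨h1, h2⟩ <;> simp [h1, h2]

theorem IsWord.singleton (b : Bool) : IsWord fun _ _ => [b] := ⟨.bit b, fun _ _ => rfl⟩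

theorem IsWord.append (hF : IsWord F) (hG : IsWord G) : IsWord fun x e => F x e ++ G x e := by
  obtain ⟨t, ht⟩ := hF
  obtain ⟨s, hs⟩ := hG
  exact ⟨.append t s, fun x e => by simp [val, ht, hs]⟩

theorem IsWord.flatMap {B : List Bool → (ℕ → ℕ) → ℕ → List Bool} (hg : IsNum g)
    (hB : IsWord fun x e => B x (fun k => e (k + 1)) (e 0)) :
    IsWord fun x e => (List.range (g x e)).flatMap fun i => B x e i := by
  obtain ⟨t, ht⟩ := hg
  obtain ⟨s, hs⟩ := hB
  exact ⟨.bind t s, fun x e => by simp only [val, ht, hs]; rfl⟩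

/-- A conditional is a concatenation over a range of length 0 or 1. -/
theorem IsWord.ite [∀ x e, Decidable (φ x e)] (hφ : IsPred φ) (hF : IsWord F) :
    IsWord fun x e => if φ x e then F x e else [] := by
  have := IsWord.flatMap (B := fun x e _ => F x e) (IsNum.indicator hφ) hF.wk
  convert this using 3
  split_ifs <;> simp

theorem IsWord.encodeUnary (hg : IsNum g) : IsWord fun x e => encodeUnary (g x e) := by
  have := (IsWord.flatMap (B := fun _ _ _ => [true]) hg (.singleton true)).append (.singleton false)
  convert this using 3
  rw [_root_.encodeUnary, ← List.map_eq_flatMap, List.map_const', List.length_range]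

end Closure

/-! ### The kernel as a word -/

/-- The number of positions before `i` at which the word has no `1`. -/
def zerosBefore (x : List Bool) (i : ℕ) : ℕ :=
  ∑ j ∈ Finset.range i, if ¬ x[j]? = some true then 1 else 0

/-- The number of `1`s that have exactly `k` zeros before them. -/
def block (x : List Bool) (k : ℕ) : ℕ :=
  ∑ i ∈ Finset.range x.length, if x[i]? = some true ∧ zerosBefore x i = k then 1 else 0

/-- The number of votes that prefer `a` to `b`, read from the word that encodes an instance. -/
def prefersCount (x : List Bool) (a b : ℕ) : ℕ :=
  ∑ v ∈ Finset.range (block x 3),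
    if ∃ j < block x 0, ∃ i < j, block x (4 + v * block x 0 + i) = a ∧
      block x (4 + v * block x 0 + j) = b then 1 else 0

/-- The units of weight that are not removed. Here and below, there are `m` candidates, `M`
manipulators and `n` votes, and `N a b` of the votes prefer `a` to `b`; the weight of `(a, b)`
consists of the units `t` with `n + 2 * t < 2 * N a b`. -/
def Kept (m M n : ℕ) (N : ℕ → ℕ → ℕ) (t : ℕ) : Prop :=
  t ≤ M ∨ ∃ a < m, ∃ b < m, 2 * N a b ≤ n + 2 * t ∧ n + 2 * t ≤ 2 * N a b + 2 * M + 1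

/-- The unit `t` of the weight of `(a, b)` is realized by a pair of votes. If the number of
votes is odd, then the vote `0 ≻ 1 ≻ ⋯` provides one unit for all `a < b`. -/
def Emits (m M n : ℕ) (N : ℕ → ℕ → ℕ) (a b t : ℕ) : Prop :=
  a ≠ b ∧ n + 2 * t < 2 * N a b ∧ Kept m M n N t ∧ ¬ (t = 0 ∧ a < b ∧ ∃ i < n, n = 2 * i + 1)

/-- The vote `a ≻ b ≻ ⋯`, where the other candidates follow in increasing order, and the vote
`⋯ ≻ a ≻ b`, where the other candidates precede in decreasing order. -/
def votePairWord (m a b : ℕ) : List Bool :=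
  (encodeUnary a ++ (encodeUnary b ++
    (List.range m).flatMap fun i => if i ≠ a ∧ i ≠ b then encodeUnary i else [])) ++
  (((List.range m).flatMap fun i =>
    if m - 1 - i ≠ a ∧ m - 1 - i ≠ b then encodeUnary (m - 1 - i) else []) ++
    (encodeUnary a ++ encodeUnary b))

open Classical in
/-- Concatenate `w₀` if the number of votes is odd, and `w a b` for all emitted units. -/
noncomputable def emitAll {α : Type*} (m M n : ℕ) (N : ℕ → ℕ → ℕ) (w₀ : List α)
    (w : ℕ → ℕ → List α) : List α :=
  (if ∃ i < n, n = 2 * i + 1 then w₀ else []) ++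
    (List.range m).flatMap fun a => (List.range m).flatMap fun b => (List.range n).flatMap fun t =>
      if Emits m M n N a b t then w a b else []

/-- The word that encodes the kernel. -/
noncomputable def kernelWord (m c M n : ℕ) (N : ℕ → ℕ → ℕ) : List Bool :=
  encodeUnary m ++ (encodeUnary c ++ (encodeUnary M ++
    ((emitAll m M n N [true] (fun _ _ => [true] ++ [true]) ++ [false]) ++
      emitAll m M n N ((List.range m).flatMap encodeUnary) (votePairWord m))))

/-! ### The kernel word is denoted by a term. -/

section Closure

variable {g h : List Bool → (ℕ → ℕ) → ℕ}

theorem IsNum.zerosBefore (hg : IsNum g) : IsNum fun x e => zerosBefore x (g x e) :=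
  .sum hg (.indicator (.not (.lookup (.var 0))))

theorem IsNum.block (hg : IsNum g) : IsNum fun x e => block x (g x e) :=
  .sum .len (.indicator (.and (.lookup (.var 0)) (.eq (.zerosBefore (.var 0)) hg.wk)))

theorem IsNum.numCandidates : IsNum fun x _ => _root_.block x 0 := .block (.const 0)

theorem IsNum.numManip : IsNum fun x _ => _root_.block x 2 := .block (.const 2)

theorem IsNum.numVotes : IsNum fun x _ => _root_.block x 3 := .block (.const 3)

theorem IsNum.prefersCount (hg : IsNum g) (hh : IsNum h) :
    IsNum fun x e => prefersCount x (g x e) (h x e) :=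
  .sum .numVotes (.indicator (.exists_lt .numCandidates (.exists_lt (.var 0) (.and
    (.eq (.block (.add (.add (.const 4) (.mul (.var 2) .numCandidates)) (.var 0))) hg.wk.wk.wk)
    (.eq (.block (.add (.add (.const 4) (.mul (.var 2) .numCandidates)) (.var 1)))
      hh.wk.wk.wk)))))

theorem IsPred.kept (hg : IsNum g) :
    IsPred fun x e => Kept (block x 0) (block x 2) (block x 3) (prefersCount x) (g x e) :=
  .or (.le hg .numManip) (.exists_lt .numCandidates (.exists_lt .numCandidates (.and
    (.le (.mul (.const 2) (.prefersCount (.var 1) (.var 0)))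
      (.add .numVotes (.mul (.const 2) hg.wk.wk)))
    (.le (.add .numVotes (.mul (.const 2) hg.wk.wk))
      (.add (.add (.mul (.const 2) (.prefersCount (.var 1) (.var 0)))
        (.mul (.const 2) .numManip)) (.const 1))))))

theorem IsPred.oddVotes : IsPred fun x _ => ∃ i < block x 3, block x 3 = 2 * i + 1 :=
  .exists_lt .numVotes (.eq .numVotes (.add (.mul (.const 2) (.var 0)) (.const 1)))

/-- Inside the three nested ranges of `emitAll`, the variables 2, 1, 0 are a, b and the unit t. -/
theorem IsPred.emits : IsPred fun x e =>
    Emits (block x 0) (block x 2) (block x 3) (prefersCount x) (e 2) (e 1) (e 0) :=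
  .and (.not (.eq (.var 2) (.var 1))) (.and
    (.lt (.add .numVotes (.mul (.const 2) (.var 0)))
      (.mul (.const 2) (.prefersCount (.var 2) (.var 1))))
    (.and (.kept (.var 0)) (.not (.and (.eq (.var 0) (.const 0)) (.and (.lt (.var 2) (.var 1))
      .oddVotes)))))

theorem IsWord.votePairWord (hg : IsNum g) (hh : IsNum h) :
    IsWord fun x e => votePairWord (block x 0) (g x e) (h x e) :=
  have hlast : IsNum fun x e => _root_.block x 0 - 1 - e 0 :=
    .sub (.sub .numCandidates (.const 1)) (.var 0)
  .append
    (.append (.encodeUnary hg) (.append (.encodeUnary hh) (.flatMap .numCandidates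
      (.ite (.and (.not (.eq (.var 0) hg.wk)) (.not (.eq (.var 0) hh.wk)))
        (.encodeUnary (.var 0))))))
    (.append (.flatMap .numCandidates
      (.ite (.and (.not (.eq hlast hg.wk)) (.not (.eq hlast hh.wk))) (.encodeUnary hlast)))
      (.append (.encodeUnary hg) (.encodeUnary hh)))

open Classical in
theorem IsWord.emitAll {F : List Bool → (ℕ → ℕ) → List Bool} (hF : IsWord F)
    {w : List Bool → ℕ → ℕ → List Bool} (hw : IsWord fun x e => w x (e 2) (e 1)) :
    IsWord fun x e => emitAll (block x 0) (block x 2) (block x 3) (prefersCount x) (F x e) (w x) :=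
  .append (.ite .oddVotes hF) (.flatMap .numCandidates (.flatMap .numCandidates
    (.flatMap .numVotes (.ite .emits hw))))

theorem IsWord.kernelWord : IsWord fun x _ =>
    kernelWord (block x 0) (block x 1) (block x 2) (block x 3) (prefersCount x) :=
  .append (.encodeUnary .numCandidates) (.append (.encodeUnary (.block (.const 1)))
    (.append (.encodeUnary .numManip) (.append
      (.append (.emitAll (.singleton true) (.append (.singleton true) (.singleton true)))
        (.singleton false))
      (.emitAll (.flatMap .numCandidates (.encodeUnary (.var 0)))
        (.votePairWord (.var 2) (.var 1))))))

end Closure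

/-! ### Reading an encoded instance -/

theorem zerosBefore_cons (b : Bool) (x : List Bool) (i : ℕ) :
    zerosBefore (b :: x) (i + 1) = zerosBefore x i + if b = true then 0 else 1 := by
  rw [zerosBefore, Finset.sum_range_succ', zerosBefore]
  cases b <;> simp

theorem block_true_cons (x : List Bool) (k : ℕ) :
    block (true :: x) k = block x k + if k = 0 then 1 else 0 := by
  rw [block, List.length_cons, Finset.sum_range_succ', block]
  have h0 : zerosBefore (true :: x) 0 = 0 := rfl
  simp [zerosBefore_cons, h0, eq_comm]

theorem block_false_cons_zero (x : List Bool) : block (false :: x) 0 = 0 := by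
  rw [block, List.length_cons, Finset.sum_range_succ']
  simp [zerosBefore_cons]

theorem block_false_cons_succ (x : List Bool) (k : ℕ) :
    block (false :: x) (k + 1) = block x k := by
  rw [block, List.length_cons, Finset.sum_range_succ', block]
  simp [zerosBefore_cons]

theorem block_encodeUnary_append_zero (a : ℕ) (x : List Bool) :
    block (encodeUnary a ++ x) 0 = a := by
  induction a with
  | zero => exact block_false_cons_zero x
  | succ a ih =>
    rw [encodeUnary, List.replicate_succ, List.cons_append, List.cons_append, block_true_cons]
    rw [encodeUnary] at ih
    simp only [ih, if_true]

theorem block_encodeUnary_append_succ (a : ℕ) (x : List Bool) (k : ℕ) :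
    block (encodeUnary a ++ x) (k + 1) = block x k := by
  induction a with
  | zero => exact block_false_cons_succ x k
  | succ a ih =>
    rw [encodeUnary, List.replicate_succ, List.cons_append, List.cons_append, block_true_cons]
    rw [encodeUnary] at ih
    simp only [ih, reduceCtorEq, if_false, Nat.add_zero]

/-- Each unary number contributes exactly one zero, at its end, so the ones preceded by k zeros are
those of the k-th number. -/
theorem block_flatMap_encodeUnary (l : List ℕ) (k : ℕ) :
    block (l.flatMap encodeUnary) k = l.getD k 0 := by
  induction l generalizing k with
  | nil => simp [block]
  | cons a l ih =>
    cases k with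
    | zero => simp [block_encodeUnary_append_zero]
    | succ k => simp [block_encodeUnary_append_succ, ih]

theorem encodeVote_eq_flatMap {m : ℕ} (v : Vote m) :
    encodeVote v = ((List.finRange m).map fun i => (v i : ℕ)).flatMap encodeUnary := by
  rw [encodeVote, List.flatMap_map]

/-- The candidates in the order in which they occur in the votes. -/
def candidateList {m : ℕ} (V : List (Vote m)) : List ℕ :=
  V.flatMap fun v => (List.finRange m).map fun i => (v i : ℕ)

theorem getD_candidateList {m : ℕ} (V : List (Vote m)) {v : ℕ} (hv : v < V.length) (i : Fin m) :
    (candidateList V).getD (v * m + i) 0 = V[v] i := by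
  induction V generalizing v with
  | nil => simp at hv
  | cons w V ih =>
    rw [candidateList, List.flatMap_cons, List.getD_eq_getElem?_getD]
    cases v with
    | zero =>
      rw [List.getElem?_append_left (by simp)]
      simp
    | succ v =>
      rw [List.getElem?_append_right (by simp; nlinarith), ← List.getD_eq_getElem?_getD]
      have := ih (v := v) (by simpa using hv)
      rw [candidateList] at this
      convert this using 2
      · simp only [List.length_map, List.length_finRange, Nat.succ_mul]
        omega
      · rfl

theorem CMInstance.encode_eq_flatMap (I : CMInstance) : I.encode =
    (I.m :: (I.c : ℕ) :: I.numManip :: I.votes.length :: candidateList I.votes).flatMap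
      encodeUnary := by
  simp only [CMInstance.encode, candidateList, List.flatMap_cons, List.flatMap_assoc,
    ← encodeVote_eq_flatMap]

theorem sum_range_eq_countP {α : Type*} (l : List α) (P : ℕ → Prop) [DecidablePred P]
    (p : α → Bool) (h : ∀ i (hi : i < l.length), P i ↔ p l[i] = true) :
    ∑ i ∈ Finset.range l.length, (if P i then 1 else 0) = l.countP p := by
  induction l generalizing P with
  | nil => simp
  | cons a l ih =>
    rw [List.length_cons, Finset.sum_range_succ', List.countP_cons,
      ih (fun i => P (i + 1)) (fun i hi => h (i + 1) (Nat.succ_lt_succ hi))]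
    have h0 : P 0 ↔ p a = true := h 0 (Nat.succ_pos _)
    simp only [h0]

theorem Vote.prefers_iff {m : ℕ} (v : Vote m) (a b : Fin m) :
    v.Prefers a b ↔ ∃ j < m, ∃ i < j, ∃ hj : j < m, ∃ hi : i < m,
      (v ⟨i, hi⟩ : ℕ) = a ∧ (v ⟨j, hj⟩ : ℕ) = b := by
  constructor
  · intro h
    exact ⟨v.symm b, (v.symm b).2, v.symm a, h, (v.symm b).2, (v.symm a).2, by simp, by simp⟩
  · rintro ⟨j, -, i, hij, hj, hi, ha, hb⟩
    have ha' : v.symm a = ⟨i, hi⟩ := by rw [← Fin.ext ha]; simp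
    have hb' : v.symm b = ⟨j, hj⟩ := by rw [← Fin.ext hb]; simp
    rw [Vote.Prefers, ha', hb']
    exact hij

namespace CMInstance

variable (I : CMInstance)

theorem block_encode_zero : block I.encode 0 = I.m := by
  rw [encode_eq_flatMap, block_flatMap_encodeUnary]; rfl

theorem block_encode_one : block I.encode 1 = I.c := by
  rw [encode_eq_flatMap, block_flatMap_encodeUnary]; rfl

theorem block_encode_two : block I.encode 2 = I.numManip := by
  rw [encode_eq_flatMap, block_flatMap_encodeUnary]; rfl

theorem block_encode_three : block I.encode 3 = I.votes.length := by
  rw [encode_eq_flatMap, block_flatMap_encodeUnary]; rfl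

theorem block_encode_vote {v : ℕ} (hv : v < I.votes.length) (i : Fin I.m) :
    block I.encode (4 + v * I.m + i) = I.votes[v] i := by
  rw [encode_eq_flatMap, block_flatMap_encodeUnary,
    show 4 + v * I.m + (i : ℕ) = (v * I.m + i) + 1 + 1 + 1 + 1 by omega]
  simp only [List.getD_cons_succ]
  exact getD_candidateList _ hv i

theorem prefersCount_encode (a b : Fin I.m) :
    prefersCount I.encode a b = I.votes.countP fun v => v.Prefers a b := by
  rw [prefersCount, block_encode_three, block_encode_zero]
  refine sum_range_eq_countP _ _ _ fun v hv => ?_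
  rw [decide_eq_true_iff, Vote.prefers_iff]
  refine exists_congr fun j => and_congr_right fun hj => exists_congr fun i =>
    and_congr_right fun hi => ?_
  rw [I.block_encode_vote hv ⟨i, hi.trans hj⟩, I.block_encode_vote hv ⟨j, hj⟩]
  simp [hj, hi.trans hj]

end CMInstance

/-! ### Removing units of weight -/

section Units

variable {m M n : ℕ} {N : ℕ → ℕ → ℕ}

open Classical in
/-- The number of units below `u` that are kept. -/
noncomputable def keptBelow (m M n : ℕ) (N : ℕ → ℕ → ℕ) (u : ℕ) : ℕ :=
  ((Finset.range u).filter (Kept m M n N)).card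

/-- The numbers of units of the weights, and `0`. -/
def IsLevel (m n : ℕ) (N : ℕ → ℕ → ℕ) (p : ℕ) : Prop :=
  p = 0 ∨ ∃ a < m, ∃ b < m, p = N a b - n / 2

/-- For a level p = N a b - n / 2 that is not truncated, the inequalities in `Kept` say p ≤ t ≤ p +
M for both parities of n; a truncated one is the level 0, covered by t ≤ M. -/
theorem IsLevel.kept {p t : ℕ} (hp : IsLevel m n N p) (h1 : p ≤ t) (h2 : t ≤ p + M) :
    Kept m M n N t := by
  rcases hp with rfl | ⟨a, ha, b, hb, rfl⟩
  · exact Or.inl (by omega)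
  · by_cases h : t ≤ M
    · exact Or.inl h
    · exact Or.inr ⟨a, ha, b, hb, by omega, by omega⟩

theorem Kept.exists_isLevel {t : ℕ} (h : Kept m M n N t) :
    ∃ p, IsLevel m n N p ∧ p ≤ t ∧ t ≤ p + M := by
  rcases h with h | ⟨a, ha, b, hb, h1, h2⟩
  · exact ⟨0, Or.inl rfl, by omega, by omega⟩
  · exact ⟨N a b - n / 2, Or.inr ⟨a, ha, b, hb, rfl⟩, by omega, by omega⟩

@[simp]
theorem keptBelow_zero : keptBelow m M n N 0 = 0 := by simp [keptBelow]

open Classical in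
theorem keptBelow_eq_add {p q : ℕ} (h : p ≤ q) : keptBelow m M n N q =
    keptBelow m M n N p + ((Finset.Ico p q).filter (Kept m M n N)).card := by
  rw [keptBelow, keptBelow, Finset.range_eq_Ico, ← Finset.Ico_union_Ico_eq_Ico (Nat.zero_le p) h,
    Finset.filter_union, Finset.card_union_of_disjoint, Finset.range_eq_Ico]
  exact Finset.disjoint_filter_filter (Finset.Ico_disjoint_Ico_consecutive 0 p q)

theorem keptBelow_mono {p q : ℕ} (h : p ≤ q) : keptBelow m M n N p ≤ keptBelow m M n N q := by
  rw [keptBelow_eq_add h]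
  exact Nat.le_add_right _ _

theorem keptBelow_eq_add_sub {p q : ℕ} (hp : IsLevel m n N p) (h1 : p ≤ q) (h2 : q ≤ p + M + 1) :
    keptBelow m M n N q = keptBelow m M n N p + (q - p) := by
  classical
  rw [keptBelow_eq_add h1, Finset.filter_true_of_mem, Nat.card_Ico]
  intro t ht
  rw [Finset.mem_Ico] at ht
  exact hp.kept ht.1 (by omega)

/-- Differences of weights are preserved unless they exceed `M` units before and after. -/
theorem keptBelow_dichotomy {p q : ℕ} (hp : IsLevel m n N p) (h : p ≤ q) :
    keptBelow m M n N q = keptBelow m M n N p + (q - p) ∨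
      (p + M + 1 ≤ q ∧ keptBelow m M n N p + (M + 1) ≤ keptBelow m M n N q) := by
  by_cases hq : q ≤ p + M + 1
  · exact Or.inl (keptBelow_eq_add_sub hp h hq)
  · refine Or.inr ⟨by omega, ?_⟩
    have h1 := keptBelow_eq_add_sub (M := M) hp (Nat.le_add_right p (M + 1)) (by omega)
    have h2 := keptBelow_mono (m := m) (M := M) (n := n) (N := N) (show p + (M + 1) ≤ q by omega)
    omega

theorem keptBelow_lt {p q : ℕ} (hp : IsLevel m n N p) (h : p < q) :
    keptBelow m M n N p < keptBelow m M n N q := by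
  rcases keptBelow_dichotomy (M := M) hp h.le with h | h <;> omega

/-- The next lower level is at most `M + 1` kept units below. -/
theorem exists_isLevel_lt {u : ℕ} (hu : 0 < u) : ∃ p, IsLevel m n N p ∧ p < u ∧
    keptBelow m M n N u ≤ keptBelow m M n N p + (M + 1) := by
  classical
  obtain ⟨p, hp, hmax⟩ := Finset.exists_max_image ((Finset.range u).filter (IsLevel m n N)) id
    ⟨0, by simp [hu, IsLevel]⟩
  simp only [Finset.mem_filter, Finset.mem_range, id_eq, and_imp] at hp hmax
  refine ⟨p, hp.2, hp.1, ?_⟩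
  rw [keptBelow_eq_add hp.1.le, Nat.add_le_add_iff_left]
  -- A kept unit below u belongs to a level below u, hence to one that is at most the maximal p, so
  -- it exceeds p by at most M.
  calc _ ≤ (Finset.Icc p (p + M)).card := Finset.card_le_card fun t ht => by
        simp only [Finset.mem_filter, Finset.mem_Ico] at ht
        obtain ⟨r, hr, hrt, htr⟩ := ht.2.exists_isLevel
        have := hmax r (by omega) hr
        rw [Finset.mem_Icc]
        omega
    _ = M + 1 := by rw [Nat.card_Icc]; omega

/-- Kept units lie in the intervals [p, p + M], where p is 0 or one of at most m² other levels. -/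
theorem keptBelow_le (u : ℕ) : keptBelow m M n N u ≤ (m * m + 1) * (M + 1) := by
  classical
  have hsub : (Finset.range u).filter (Kept m M n N) ⊆
      (insert 0 ((Finset.range m ×ˢ Finset.range m).image fun q => N q.1 q.2 - n / 2)).biUnion
        fun p => Finset.Icc p (p + M) := by
    intro t ht
    obtain ⟨p, hp, h1, h2⟩ := (Finset.mem_filter.1 ht).2.exists_isLevel
    refine Finset.mem_biUnion.2 ⟨p, ?_, Finset.mem_Icc.2 ⟨h1, h2⟩⟩
    rcases hp with rfl | ⟨a, ha, b, hb, rfl⟩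
    · exact Finset.mem_insert_self _ _
    · exact Finset.mem_insert_of_mem
        (Finset.mem_image.2 ⟨(a, b), by simp [ha, hb], rfl⟩)
  refine (Finset.card_le_card hsub).trans ((Finset.card_biUnion_le_card_mul _ _ (M + 1)
    fun p _ => by rw [Nat.card_Icc]; omega).trans (Nat.mul_le_mul_right _ ?_))
  refine (Finset.card_insert_le _ _).trans (Nat.add_le_add_right ?_ 1)
  refine Finset.card_image_le.trans ?_
  simp

open Classical in
/-- The number of emitted units of a weight. -/
theorem card_emits {a b : ℕ} (hab : a ≠ b) (hN : N a b ≤ n) :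
    ((Finset.range n).filter (Emits m M n N a b)).card +
      (if n < 2 * N a b ∧ a < b ∧ n % 2 = 1 then 1 else 0) =
    keptBelow m M n N (N a b - n / 2) := by
  have hodd : (∃ i < n, n = 2 * i + 1) ↔ n % 2 = 1 :=
    ⟨fun ⟨i, _, h⟩ => by omega, fun h => ⟨n / 2, by omega, by omega⟩⟩
  have h0 : Kept m M n N 0 := Or.inl (Nat.zero_le _)
  rw [keptBelow]
  split_ifs with h
  · rw [← Finset.card_insert_of_notMem (a := 0)
      (by simp [Emits, h.2.1, hodd, h.2.2])]
    congr 1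
    ext t
    simp only [Finset.mem_insert, Finset.mem_filter, Finset.mem_range, Emits, hodd]
    constructor
    · rintro (rfl | ⟨h1, h2, h3, h4, h5⟩)
      · exact ⟨by omega, h0⟩
      · exact ⟨by omega, h4⟩
    · rintro ⟨h1, h2⟩
      by_cases ht : t = 0
      · exact Or.inl ht
      · exact Or.inr ⟨by omega, hab, by omega, h2, fun h' => ht h'.1⟩
  · rw [Nat.add_zero]
    congr 1
    ext t
    simp only [Finset.mem_filter, Finset.mem_range, Emits, hodd]
    constructor
    · rintro ⟨h2, h3, h4, h5, h6⟩
      exact ⟨by omega, h5⟩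
    · rintro ⟨h1, h2⟩
      exact ⟨by omega, hab, by omega, h2, fun h' => h ⟨by omega, h'.2⟩⟩

end Units

/-! ### Pairs of votes that change a single margin -/

section Votes

variable {m : ℕ}

theorem length_eq_of_pairwise_of_mem {l : List (Fin m)} {key : Fin m → ℕ}
    (hk : l.Pairwise fun x y => key x < key y) (hl : ∀ x, x ∈ l) : l.length = m := by
  have hn : l.Nodup := hk.imp fun h e => by rw [e] at h; exact lt_irrefl _ h
  rw [← List.toFinset_card_of_nodup hn, Finset.eq_univ_of_forall fun x => List.mem_toFinset.2 (hl x),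
    Finset.card_univ, Fintype.card_fin]

/-- Every list of the candidates in the order of a key gives a vote. -/
theorem exists_vote {l : List (Fin m)} {key : Fin m → ℕ}
    (hk : l.Pairwise fun x y => key x < key y) (hl : ∀ x, x ∈ l) :
    ∃ v : Vote m, (List.finRange m).map v = l ∧ ∀ x y, v.Prefers x y ↔ key x < key y := by
  have hlen := length_eq_of_pairwise_of_mem hk hl
  have hn : l.Nodup := hk.imp fun h e => by rw [e] at h; exact lt_irrefl _ h
  have hinj : Function.Injective fun i : Fin m => l.get (Fin.cast hlen.symm i) := fun i j h => by
    simpa using hn.injective_get h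
  refine ⟨Equiv.ofBijective _ (Finite.injective_iff_bijective.1 hinj), ?_, ?_⟩
  · exact List.ext_getElem (by simp [hlen]) (by simp)
  · set v : Vote m := Equiv.ofBijective _ (Finite.injective_iff_bijective.1 hinj) with hv
    have hmono : StrictMono fun i => key (v i) := fun i j hij =>
      List.pairwise_iff_get.1 hk (Fin.cast hlen.symm i) (Fin.cast hlen.symm j) hij
    intro x y
    rw [Vote.Prefers, ← hmono.lt_iff_lt]
    simp

/-- The contribution of a vote to the margin of `(x, y)`. -/
def voteMargin (x y : Fin m) (v : Vote m) : ℤ :=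
  (if v.Prefers x y then 1 else 0) - if v.Prefers y x then 1 else 0

theorem margin_eq_sum (V : List (Vote m)) (x y : Fin m) :
    margin V x y = (V.map (voteMargin x y)).sum := by
  induction V with
  | nil => simp [margin]
  | cons v V ih =>
    rw [List.map_cons, List.sum_cons, ← ih, margin, margin, List.countP_cons, List.countP_cons,
      voteMargin]
    simp only [decide_eq_true_eq]
    push_cast
    ring

theorem margin_append (V W : List (Vote m)) (x y : Fin m) :
    margin (V ++ W) x y = margin V x y + margin W x y := by
  simp [margin_eq_sum]

theorem flatMap_filter_eq {α β : Type*} (l : List α) (p : α → Prop) [DecidablePred p]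
    (g : α → List β) :
    (l.filter fun i => p i).flatMap g = l.flatMap fun i => if p i then g i else [] := by
  induction l with
  | nil => rfl
  | cons a l ih =>
    by_cases h : p a <;> simp [h, ih]

theorem flatMap_finRange_eq {β : Type*} (g : ℕ → List β) :
    ((List.finRange m).flatMap fun i : Fin m => g i) = (List.range m).flatMap g := by
  rw [← List.map_coe_finRange_eq_range, List.flatMap_map]

/-- McGarvey's pair: the two votes agree on a ≻ b and order every other pair oppositely, so all
other contributions cancel. The keys shift the other candidates by 2 behind a and b in one vote, and
put a and b at m and m + 1, behind all reversed indices, in the other. -/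
theorem exists_votePair {a b : Fin m} (hab : a ≠ b) : ∃ v w : Vote m,
    encodeVote v ++ encodeVote w = votePairWord m a b ∧
    ∀ x y, voteMargin x y v + voteMargin x y w =
      (if x = a ∧ y = b then 2 else 0) - if y = a ∧ x = b then 2 else 0 := by
  obtain ⟨v, hv, hpv⟩ := exists_vote
    (l := a :: b :: (List.finRange m).filter fun i => i ≠ a ∧ i ≠ b)
    (key := fun x => if x = a then 0 else if x = b then 1 else x + 2)
    (by
      simp only [List.pairwise_cons, List.mem_cons, List.mem_filter, decide_eq_true_eq,
        List.pairwise_filter]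
      refine ⟨?_, ?_, ?_⟩
      · rintro x (rfl | ⟨-, h1, h2⟩)
        · simp [hab.symm]
        · simp [h1, h2]
      · rintro x ⟨-, h1, h2⟩
        simp [h1, h2, hab.symm]
      · refine (List.pairwise_lt_finRange m).imp fun {x y} hxy hx hy => ?_
        simpa [hx, hy] using hxy)
    (fun x => by simp; tauto)
  obtain ⟨w, hw, hpw⟩ := exists_vote
    (l := ((List.finRange m).map Fin.rev).filter (fun i => i ≠ a ∧ i ≠ b) ++ [a, b])
    (key := fun x => if x = a then m else if x = b then m + 1 else x.rev)
    (by
      simp only [List.pairwise_append, List.mem_filter, decide_eq_true_eq,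
        List.pairwise_filter, List.pairwise_map]
      refine ⟨?_, ?_, ?_⟩
      · refine (List.pairwise_lt_finRange m).imp fun {x y} hxy hx hy => ?_
        simpa [hx, hy] using hxy
      · simp [hab.symm]
      · rintro x ⟨-, h1, h2⟩ y hy
        have hx := x.rev.2
        simp only [List.mem_cons, List.not_mem_nil, or_false] at hy
        rcases hy with rfl | rfl
        · simpa [h1, h2] using hx
        · simp only [h1, h2, hab.symm, if_true, if_false]
          omega)
    (fun x => by
      simp only [List.mem_append, List.mem_filter, List.mem_map, List.mem_finRange, true_and]
      have : ∃ y : Fin m, y.rev = x := ⟨x.rev, Fin.rev_rev x⟩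
      simp
      tauto)
  refine ⟨v, w, ?_, fun x y => ?_⟩
  · have hv' : encodeVote v = ((List.finRange m).map v).flatMap fun i : Fin m => encodeUnary i := by
      rw [List.flatMap_map]; rfl
    have hw' : encodeVote w = ((List.finRange m).map w).flatMap fun i : Fin m => encodeUnary i := by
      rw [List.flatMap_map]; rfl
    rw [hv', hw', hv, hw, votePairWord]
    simp only [List.flatMap_cons, List.flatMap_append, flatMap_filter_eq, List.flatMap_map,
      List.flatMap_nil, List.append_nil]
    rw [← flatMap_finRange_eq, ← flatMap_finRange_eq]
    have hrev : ∀ i : Fin m, (i.rev : ℕ) = m - 1 - i := fun i => by rw [Fin.val_rev]; omega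
    simp only [Fin.ext_iff, ne_eq, hrev, List.append_assoc]
  · simp only [voteMargin, hpv, hpw]
    have hx := x.rev.2
    have hy := y.rev.2
    have hxy : (x : ℕ) < y ↔ (y.rev : ℕ) < x.rev := by rw [Fin.val_rev, Fin.val_rev]; omega
    have hyx : (y : ℕ) < x ↔ (x.rev : ℕ) < y.rev := by rw [Fin.val_rev, Fin.val_rev]; omega
    by_cases h1 : x = a <;> by_cases h2 : y = a <;> by_cases h3 : x = b <;> by_cases h4 : y = b <;>
      simp only [h1, h2, h3, h4, hab, hab.symm, if_true, if_false, and_true, and_false] <;>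
      split_ifs <;> omega

end Votes

/-! ### The votes of the kernel -/

section Emit

variable {m M n : ℕ} {N : ℕ → ℕ → ℕ} {α β : Type*}

theorem exists_eq_two_mul_add_one_iff : (∃ i < n, n = 2 * i + 1) ↔ n % 2 = 1 :=
  ⟨fun ⟨i, _, h⟩ => by omega, fun h => ⟨n / 2, by omega, by omega⟩⟩

/-- This ties the list of votes to its unary length and to its code: all three are `emitAll` with
different entries. -/
theorem flatMap_emitAll (w₀ : List α) (w : ℕ → ℕ → List α) (g : α → List β) :
    (emitAll m M n N w₀ w).flatMap g =
      emitAll m M n N (w₀.flatMap g) fun a b => (w a b).flatMap g := by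
  classical
  simp only [emitAll, List.flatMap_append, List.flatMap_assoc, apply_ite (List.flatMap g),
    List.flatMap_nil]

theorem emitAll_congr {w₀ : List α} {w w' : ℕ → ℕ → List α}
    (h : ∀ a < m, ∀ b < m, a ≠ b → w a b = w' a b) :
    emitAll m M n N w₀ w = emitAll m M n N w₀ w' := by
  rw [emitAll, emitAll]
  congr 1
  refine List.flatMap_congr fun a ha => List.flatMap_congr fun b hb => List.flatMap_congr
    fun t _ => ?_
  split_ifs with he
  · exact h a (List.mem_range.1 ha) b (List.mem_range.1 hb) he.1
  · rfl

-- Applied with g = 1 it gives the number of votes, with g = `voteMargin x y` the margins.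
open Classical in
theorem sum_map_emitAll {R : Type*} [CommRing R] (w₀ : List α) (w : ℕ → ℕ → List α) (g : α → R) :
    ((emitAll m M n N w₀ w).map g).sum = (if n % 2 = 1 then (w₀.map g).sum else 0) +
      ∑ a ∈ Finset.range m, ∑ b ∈ Finset.range m,
        (((Finset.range n).filter (Emits m M n N a b)).card : R) * ((w a b).map g).sum := by
  have hsum : ∀ (k : ℕ) (f : ℕ → List α), (((List.range k).flatMap f).map g).sum =
      ∑ i ∈ Finset.range k, ((f i).map g).sum := fun k f => by
    rw [List.map_flatMap, List.flatMap_def, List.sum_flatten, List.map_map]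
    rfl
  rw [emitAll, List.map_append, List.sum_append, hsum]
  congr 1
  · simp only [exists_eq_two_mul_add_one_iff, apply_ite (List.map g), apply_ite List.sum,
      List.map_nil, List.sum_nil]
  · refine Finset.sum_congr rfl fun a _ => ?_
    rw [hsum]
    refine Finset.sum_congr rfl fun b _ => ?_
    rw [hsum]
    simp only [apply_ite (List.map g), apply_ite List.sum, List.map_nil, List.sum_nil]
    rw [← Finset.sum_filter, Finset.sum_const, nsmul_eq_mul]

end Emit

theorem encodeVote_one (m : ℕ) :
    encodeVote (1 : Vote m) = (List.range m).flatMap encodeUnary :=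
  flatMap_finRange_eq encodeUnary

theorem voteMargin_one {m : ℕ} (x y : Fin m) :
    voteMargin x y (1 : Vote m) = (if x < y then 1 else 0) - if y < x then 1 else 0 := rfl

theorem encodeVote_length_le {m : ℕ} (v : Vote m) : (encodeVote v).length ≤ m * m := by
  rw [encodeVote, List.length_flatMap]
  refine (List.sum_le_card_nsmul _ m fun k hk => ?_).trans (by simp)
  obtain ⟨i, -, rfl⟩ := List.mem_map.1 hk
  simp [encodeUnary]

/-- A list of votes for `m` candidates, of which `N a b` prefer `a` to `b` and `n` in total, can be
replaced by a short one with the margins determined by the units that are kept. -/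
theorem exists_kernelVotes (m c M n : ℕ) (N : ℕ → ℕ → ℕ)
    (hN : ∀ x y : Fin m, x ≠ y → N x y + N y x = n) : ∃ V : List (Vote m),
    kernelWord m c M n N = encodeUnary m ++ (encodeUnary c ++ (encodeUnary M ++
      (encodeUnary V.length ++ V.flatMap encodeVote))) ∧
    V.length ≤ 1 + m * m * (2 * ((m * m + 1) * (M + 1))) ∧
    ∀ x y : Fin m, x ≠ y → n ≤ 2 * N x y →
      (n = 2 * N x y → margin V x y = 0) ∧
      (n < 2 * N x y → margin V x y =
        2 * (keptBelow m M n N (N x y - n / 2) : ℤ) - ((n % 2 : ℕ) : ℤ)) := by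
  classical
  -- The pair of votes is made total in a and b, with the empty list where there is no such pair,
  -- since `emitAll` ranges over natural numbers.
  have hpair : ∀ a b : ℕ, ∃ P : List (Vote m), ∀ (ha : a < m) (hb : b < m), a ≠ b →
      P.length = 2 ∧ P.flatMap encodeVote = votePairWord m a b ∧
      ∀ x y, (P.map (voteMargin x y)).sum =
        (if x = ⟨a, ha⟩ ∧ y = ⟨b, hb⟩ then 2 else 0) -
          if y = ⟨a, ha⟩ ∧ x = ⟨b, hb⟩ then 2 else 0 := by
    intro a b
    by_cases h : ∃ (_ : a < m) (_ : b < m), a ≠ b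
    · obtain ⟨ha, hb, hab⟩ := h
      obtain ⟨v, w, h1, h2⟩ := exists_votePair (a := ⟨a, ha⟩) (b := ⟨b, hb⟩) (by simpa using hab)
      exact ⟨[v, w], fun _ _ _ => ⟨rfl, by simpa using h1, by simpa using h2⟩⟩
    · exact ⟨[], fun ha hb hab => absurd ⟨ha, hb, hab⟩ h⟩
  choose P hP using hpair
  set E : ℕ → ℕ → ℕ := fun a b => ((Finset.range n).filter (Emits m M n N a b)).card with hE
  have hEself : ∀ a, E a a = 0 := fun a => by simp [hE, Emits]
  have hEeq : ∀ x y : Fin m, x ≠ y →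
      E x y + (if n < 2 * N x y ∧ (x : ℕ) < y ∧ n % 2 = 1 then 1 else 0) =
        keptBelow m M n N (N x y - n / 2) := fun x y hxy =>
    card_emits (by simpa [Fin.ext_iff] using hxy) (by have := hN x y hxy; omega)
  refine ⟨emitAll m M n N [1] P, ?_, ?_, ?_⟩
  · rw [kernelWord, flatMap_emitAll,
      emitAll_congr fun a ha b hb hab => (hP a b ha hb hab).2.1]
    have hlen : emitAll m M n N [true] (fun _ _ => [true] ++ [true]) =
        List.replicate (emitAll m M n N [1] P).length true := by
      rw [← List.map_const', List.map_eq_flatMap, flatMap_emitAll]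
      refine emitAll_congr fun a ha b hb hab => ?_
      rw [← List.map_eq_flatMap, List.map_const', (hP a b ha hb hab).1]
      rfl
    rw [hlen, List.flatMap_singleton, encodeVote_one]
    rfl
  · have hsum := sum_map_emitAll (m := m) (M := M) (n := n) (N := N) [1] P (fun _ => (1 : ℤ))
    simp only [List.map_const', List.sum_replicate, nsmul_eq_mul, mul_one, List.length_singleton]
      at hsum
    have hterm : ∀ a ∈ Finset.range m, ∀ b ∈ Finset.range m,
        ((E a b : ℕ) : ℤ) * ((P a b).length : ℤ) ≤ ((2 * ((m * m + 1) * (M + 1)) : ℕ) : ℤ) := by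
      intro a ha b hb
      rw [Finset.mem_range] at ha hb
      by_cases hab : a = b
      · rw [hab, hEself, Nat.cast_zero, zero_mul]
        exact Nat.cast_nonneg _
      · rw [(hP a b ha hb hab).1]
        have h1 := hEeq ⟨a, ha⟩ ⟨b, hb⟩ (by simpa using hab)
        have h2 := keptBelow_le (m := m) (M := M) (n := n) (N := N) (N a b - n / 2)
        simp only at h1
        have h3 : E a b * 2 ≤ 2 * ((m * m + 1) * (M + 1)) := by omega
        exact_mod_cast h3
    have hbound := Finset.sum_le_sum fun a ha => Finset.sum_le_sum (hterm a ha)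
    simp only [Finset.sum_const, Finset.card_range, nsmul_eq_mul] at hbound
    have hone : (if n % 2 = 1 then ((1 : ℕ) : ℤ) else 0) ≤ 1 := by split_ifs <;> simp
    have : ((emitAll m M n N [1] P).length : ℤ) ≤
        ((1 + m * m * (2 * ((m * m + 1) * (M + 1))) : ℕ) : ℤ) := by
      rw [hsum]
      push_cast at hbound hone ⊢
      linarith
    exact_mod_cast this
  · intro x y hxy hle
    have hsum := sum_map_emitAll (m := m) (M := M) (n := n) (N := N) [1] P (voteMargin x y)
    rw [← margin_eq_sum] at hsum
    -- Only the vote pairs for (x, y) and (y, x) affect the margin of (x, y).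
    have hcollapse : ∑ a ∈ Finset.range m, ∑ b ∈ Finset.range m,
        ((E a b : ℕ) : ℤ) * ((P a b).map (voteMargin x y)).sum = 2 * E x y - 2 * E y x := by
      rw [Finset.sum_range]
      have : ∀ a : Fin m, ∑ b ∈ Finset.range m,
          ((E a b : ℕ) : ℤ) * ((P a b).map (voteMargin x y)).sum = ∑ b : Fin m,
          ((if x = a then if y = b then 2 * (E a b : ℤ) else 0 else 0) -
            if y = a then if x = b then 2 * (E a b : ℤ) else 0 else 0) := by
        intro a
        rw [Finset.sum_range]
        refine Finset.sum_congr rfl fun b _ => ?_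
        by_cases hab : a = b
        · rw [hab, hEself]
          simp
        · rw [(hP a b a.2 b.2 (by simpa [Fin.ext_iff] using hab)).2.2]
          simp only [Fin.eta, ← ite_and]
          split_ifs <;> ring
      simp only [this, Finset.sum_sub_distrib]
      simp
    have h1 := hEeq x y hxy
    have h2 := hEeq y x hxy.symm
    have h3 := hN x y hxy
    -- The losing direction has no units, so it emits nothing.
    have h4 : N y x - n / 2 = 0 := by omega
    have hlt : (x : ℕ) < y ∨ (y : ℕ) < x := by
      have := Fin.val_ne_of_ne hxy
      omega
    rw [hcollapse] at hsum
    rw [h4, keptBelow_zero] at h2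
    rw [hsum]
    simp only [List.map_cons, List.map_nil, List.sum_cons, List.sum_nil, add_zero, voteMargin_one,
      Fin.lt_def]
    constructor
    · intro h
      rw [show N x y - n / 2 = 0 by omega, keptBelow_zero] at h1
      -- A tie forces n to be even, so the extra vote is absent.
      rw [if_neg (by omega)]
      omega
    · intro h
      generalize keptBelow m M n N (N x y - n / 2) = k at *
      split_ifs at * <;> omega

/-! ### The kernelization -/

section Margins

variable {m : ℕ}

theorem margin_antisymm (V : List (Vote m)) (x y : Fin m) : margin V y x = -margin V x y := by
  simp [margin]

theorem margin_self (V : List (Vote m)) (x : Fin m) : margin V x x = 0 := by simp [margin]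

theorem abs_margin_le (V : List (Vote m)) (x y : Fin m) : |margin V x y| ≤ V.length := by
  have h1 := List.countP_le_length (p := fun v : Vote m => v.Prefers x y) (l := V)
  have h2 := List.countP_le_length (p := fun v : Vote m => v.Prefers y x) (l := V)
  rw [abs_le, margin]
  omega

theorem countP_prefers_add {x y : Fin m} (hxy : x ≠ y) (V : List (Vote m)) :
    (V.countP fun v => v.Prefers x y) + (V.countP fun v => v.Prefers y x) = V.length := by
  induction V with
  | nil => rfl
  | cons v V ih =>
    have h : v.Prefers x y ↔ ¬ v.Prefers y x := by
      have : v.symm x ≠ v.symm y := fun h => hxy (v.symm.injective h)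
      simp only [Vote.Prefers]
      omega
    simp only [List.countP_cons, List.length_cons, decide_eq_true_eq, h]
    split_ifs <;> omega

/-- The votes enter ranked pairs only through the admissible pair orders, and these only through
comparisons of margins. -/
theorem rankedPairs_congr {V W : List (Vote m)}
    (h : ∀ a b x y, margin V x y < margin V a b ↔ margin W x y < margin W a b) :
    rankedPairs m V = rankedPairs m W := by
  have : ∀ L, IsPairOrder (margin V) L ↔ IsPairOrder (margin W) L := fun L => by
    simp only [IsPairOrder, ← not_lt, h]
  simp only [rankedPairs, this]

end Margins

/-- What the kernelization guarantees for the new votes of an instance. -/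
structure IsKernelVotes (I : CMInstance) (V' : List (Vote I.m)) : Prop where
  length_le : V'.length ≤ 1 + I.m * I.m * (2 * ((I.m * I.m + 1) * (I.numManip + 1)))
  even : ∀ a b, Even (margin V' a b - margin I.votes a b)
  gap : ∀ a b, 0 < margin V' a b → ∃ x y, 0 ≤ margin V' x y ∧ margin V' x y < margin V' a b ∧
    margin V' a b ≤ margin V' x y + (2 * (I.numManip : ℤ) + 2)
  lt_iff : ∀ T : List (Vote I.m), T.length = I.numManip → ∀ a b x y,
    (margin (I.votes ++ T) x y < margin (I.votes ++ T) a b ↔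
      margin (V' ++ T) x y < margin (V' ++ T) a b)

theorem CMInstance.exists_isKernelVotes (I : CMInstance) : ∃ V' : List (Vote I.m),
    IsKernelVotes I V' ∧
    kernelWord (block I.encode 0) (block I.encode 1) (block I.encode 2) (block I.encode 3)
      (prefersCount I.encode) = (CMInstance.mk I.m I.c I.numManip V').encode := by
  have hN : ∀ x y : Fin I.m, x ≠ y →
      prefersCount I.encode x y + prefersCount I.encode y x = I.votes.length := fun x y hxy => by
    rw [I.prefersCount_encode, I.prefersCount_encode, countP_prefers_add hxy]
  have hN0 : ∀ x : Fin I.m, prefersCount I.encode x x = 0 := fun x => by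
    rw [I.prefersCount_encode]
    simp [Vote.Prefers]
  have hD : ∀ x y : Fin I.m, margin I.votes x y =
      prefersCount I.encode x y - prefersCount I.encode y x := fun x y => by
    rw [I.prefersCount_encode, I.prefersCount_encode, margin]
  obtain ⟨V', hword, hlen, hV'⟩ :=
    exists_kernelVotes I.m I.c I.numManip I.votes.length (prefersCount I.encode) hN
  rw [I.block_encode_zero, I.block_encode_one, I.block_encode_two, I.block_encode_three]
  refine ⟨V', ?_, hword⟩
  generalize prefersCount I.encode = N at *
  generalize hn : I.votes.length = n at *
  generalize hM : I.numManip = M at *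
  set k := keptBelow I.m M n N with hk
  have hpos : ∀ p, IsLevel I.m n N p → 0 < p → 0 < k p := fun p _ hp => by
    simpa [hk] using keptBelow_lt (m := I.m) (M := M) (n := n) (N := N) (Or.inl rfl) hp
  -- a margin and its new value belong to the same level
  have hcases : ∀ x y : Fin I.m, (margin I.votes x y = 0 ∧ margin V' x y = 0) ∨
      ∃ p, IsLevel I.m n N p ∧ 0 < p ∧
        ((margin I.votes x y = 2 * (p : ℤ) - (n % 2 : ℕ) ∧
          margin V' x y = 2 * (k p : ℤ) - (n % 2 : ℕ)) ∨
        (margin I.votes x y = -(2 * (p : ℤ) - (n % 2 : ℕ)) ∧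
          margin V' x y = -(2 * (k p : ℤ) - (n % 2 : ℕ)))) := by
    intro x y
    by_cases hxy : x = y
    · subst hxy
      exact Or.inl ⟨margin_self _ _, margin_self _ _⟩
    have h1 := hN x y hxy
    have h2 := hD x y
    rcases lt_trichotomy n (2 * N x y) with h | h | h
    · refine Or.inr ⟨N x y - n / 2, Or.inr ⟨x, x.2, y, y.2, rfl⟩, by omega, Or.inl ⟨?_, ?_⟩⟩
      · rw [h2]; omega
      · exact (hV' x y hxy h.le).2 h
    · exact Or.inl ⟨by rw [h2]; omega, (hV' x y hxy h.le).1 h⟩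
    · refine Or.inr ⟨N y x - n / 2, Or.inr ⟨y, y.2, x, x.2, rfl⟩, by omega, Or.inr ⟨?_, ?_⟩⟩
      · rw [h2]; omega
      · rw [margin_antisymm, (hV' y x (Ne.symm hxy) (by omega)).2 (by omega)]
  have hdich : ∀ p q, IsLevel I.m n N p → p ≤ q → k q = k p + (q - p) ∨
      (p + M + 1 ≤ q ∧ k p + (M + 1) ≤ k q) := fun p q hp hpq => keptBelow_dichotomy hp hpq
  have hk0 : k 0 = 0 := keptBelow_zero
  refine ⟨hM ▸ hlen, ?_, ?_, ?_⟩
  · intro a b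
    rw [Int.even_iff]
    rcases hcases a b with ⟨h1, h2⟩ | ⟨p, -, -, ⟨h1, h2⟩ | ⟨h1, h2⟩⟩ <;> rw [h1, h2] <;> omega
  · intro a b hab
    rcases hcases a b with ⟨h1, h2⟩ | ⟨p, hp, hp0, ⟨h1, h2⟩ | ⟨h1, h2⟩⟩
    · omega
    · obtain ⟨q, hq, hqp, hle⟩ := exists_isLevel_lt (m := I.m) (M := M) (n := n) (N := N) hp0
      have hlt : k q < k p := keptBelow_lt hq hqp
      rw [← hk] at hle
      rcases Nat.eq_zero_or_pos q with rfl | hq0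
      · refine ⟨a, a, ?_⟩
        rw [margin_self, hM]
        omega
      · have hkq := hpos q hq hq0
        rcases hq with rfl | ⟨x, hx, y, hy, rfl⟩
        · omega
        · have hxy : (⟨x, hx⟩ : Fin I.m) ≠ ⟨y, hy⟩ := fun h => by
            have h0 := hN0 ⟨x, hx⟩
            rw [Fin.mk.injEq] at h
            subst h
            simp only at h0
            omega
          refine ⟨⟨x, hx⟩, ⟨y, hy⟩, ?_⟩
          rw [(hV' ⟨x, hx⟩ ⟨y, hy⟩ hxy (by simp only; omega)).2 (by simp only; omega), h2, hM]
          simp only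
          omega
    · have := hpos p hp hp0
      omega
  · intro T hT a b x y
    have hab := abs_le.1 (abs_margin_le T a b)
    have hxy := abs_le.1 (abs_margin_le T x y)
    rw [hT, hM] at hab hxy
    simp only [margin_append]
    rcases hcases a b with ⟨h1, h2⟩ | ⟨p, hp, hp0, hp'⟩ <;>
      rcases hcases x y with ⟨h3, h4⟩ | ⟨q, hq, hq0, hq'⟩
    · rw [h1, h2, h3, h4]
    · have h5 := hdich 0 q (Or.inl rfl) (Nat.zero_le _)
      have h6 := hpos q hq hq0
      rcases hq' with ⟨h7, h8⟩ | ⟨h7, h8⟩ <;> rw [h1, h2, h7, h8] <;> omega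
    · have h5 := hdich 0 p (Or.inl rfl) (Nat.zero_le _)
      have h6 := hpos p hp hp0
      rcases hp' with ⟨h7, h8⟩ | ⟨h7, h8⟩ <;> rw [h3, h4, h7, h8] <;> omega
    · have h5 := hdich 0 p (Or.inl rfl) (Nat.zero_le _)
      have h6 := hpos p hp hp0
      have h9 := hdich 0 q (Or.inl rfl) (Nat.zero_le _)
      have h10 := hpos q hq hq0
      -- For equal signs the gap between p and q decides. For opposite signs the margins differ by
      -- 2(p + q) - 2(n mod 2): this is unchanged if both levels are, and otherwise at least 2M + 2
      -- before and after, as the other level is positive.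
      have h11 : (p ≤ q ∧ (k q = k p + (q - p) ∨ (p + M + 1 ≤ q ∧ k p + (M + 1) ≤ k q))) ∨
          (q ≤ p ∧ (k p = k q + (p - q) ∨ (q + M + 1 ≤ p ∧ k q + (M + 1) ≤ k p))) := by
        rcases le_total p q with h | h
        · exact Or.inl ⟨h, hdich p q hp h⟩
        · exact Or.inr ⟨h, hdich q p hq h⟩
      rcases hp' with ⟨h1, h2⟩ | ⟨h1, h2⟩ <;> rcases hq' with ⟨h7, h8⟩ | ⟨h7, h8⟩ <;>
        rw [h1, h2, h7, h8] <;> omega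

theorem CMInstance.encode_length_le (I : CMInstance) : I.encode.length ≤
    2 * I.m + I.numManip + I.votes.length + 4 + I.votes.length * (I.m * I.m) := by
  have h1 : (I.votes.flatMap encodeVote).length ≤ I.votes.length * (I.m * I.m) := by
    rw [List.length_flatMap]
    refine (List.sum_le_card_nsmul _ (I.m * I.m) fun k hk => ?_).trans (by simp)
    obtain ⟨v, -, rfl⟩ := List.mem_map.1 hk
    exact encodeVote_length_le v
  have h2 := I.c.2
  simp only [CMInstance.encode, List.length_append, encodeUnary, List.length_replicate,
    List.length_singleton]
  omega

/-- The constant is 10 = 1 + 8 + 1: the extra vote, the vote pairs after bounding m² + 1 by 2m² and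
M + 1 by 2 max(1, M), and the manipulators. -/
theorem IsKernelVotes.length_add_le {I : CMInstance} {V' : List (Vote I.m)}
    (h : IsKernelVotes I V') :
    V'.length + I.numManip ≤ 10 * I.m ^ 4 * max 1 I.numManip := by
  have hm : 1 ≤ I.m := (Nat.zero_le _).trans_lt I.c.2
  have hX1 : 1 ≤ max 1 I.numManip := le_max_left _ _
  have hX2 : I.numManip ≤ max 1 I.numManip := le_max_right _ _
  set X := max 1 I.numManip
  have h1 : 1 ≤ I.m * I.m := Nat.mul_pos hm hm
  have h2 : 1 ≤ I.m ^ 4 := Nat.pos_of_ne_zero (by positivity)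
  calc V'.length + I.numManip
      ≤ 1 + I.m * I.m * (2 * ((I.m * I.m + 1) * (I.numManip + 1))) + I.numManip := by
        have := h.length_le; omega
    _ ≤ 1 * 1 + I.m * I.m * (2 * ((I.m * I.m + I.m * I.m) * (X + X))) + 1 * X := by
        gcongr
        omega
    _ ≤ I.m ^ 4 * X + I.m * I.m * (2 * ((I.m * I.m + I.m * I.m) * (X + X))) + I.m ^ 4 * X := by
        gcongr
    _ = 10 * I.m ^ 4 * X := by ring

theorem theorem9 :
    ∃ C : ℕ, ∀ p : Polynomial ℕ,
      ∃ f : (coalitionalManipulation rankedPairs p).Inst →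
          (coalitionalManipulation rankedPairs p).Inst,
        (coalitionalManipulation rankedPairs p).IsPolynomialKernelization f ∧
        ∀ I : {I : CMInstance // I.numManip ≤ p.eval I.m}, ∃ V' : List (Vote I.1.m),
          -- only the votes of the non-manipulators are changed
          (f I).1 = CMInstance.mk I.1.m I.1.c I.1.numManip V' ∧
          -- the number of votes
          V'.length + I.1.numManip ≤ C * I.1.m ^ 4 * max 1 I.1.numManip ∧
          -- all weights are changed by even offsets
          (∀ a b, Even (margin V' a b - margin I.1.votes a b)) ∧
          -- consecutive values among `0` (take `x = y`) and the positive weights are close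
          (∀ a b, 0 < margin V' a b → ∃ x y, 0 ≤ margin V' x y ∧
            margin V' x y < margin V' a b ∧
            margin V' a b ≤ margin V' x y + (2 * (I.1.numManip : ℤ) + 2)) ∧
          -- however the manipulators vote, all comparisons between margins are preserved
          (∀ T : List (Vote I.1.m), T.length = I.1.numManip → ∀ a b x y,
            (margin (I.1.votes ++ T) x y < margin (I.1.votes ++ T) a b ↔
              margin (V' ++ T) x y < margin (V' ++ T) a b)) := by
  -- Choosing the votes nonconstructively does no harm: `hword` identifies their code with
  -- `kernelWord`, which is computable.
  choose votes hvotes hword using CMInstance.exists_isKernelVotes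
  refine ⟨10, fun p => ⟨fun I => ⟨⟨I.1.m, I.1.c, I.1.numManip, votes I.1⟩, I.2⟩, ⟨?_, ?_, ?_⟩,
    fun I => ⟨votes I.1, rfl, (hvotes I.1).length_add_le, (hvotes I.1).even, (hvotes I.1).gap,
      (hvotes I.1).lt_iff⟩⟩⟩
  · obtain ⟨t, ht⟩ := IsWord.kernelWord
    exact t.computableInPolyTime fun I => (ht _ _).trans (hword I.1)
  · intro I
    -- The same manipulators' votes succeed in both instances.
    refine exists_congr fun T => and_congr_right fun hT => ?_
    rw [rankedPairs_congr ((hvotes I.1).lt_iff T hT)]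
  · refine ⟨2 * Polynomial.X + p + 4 + 10 * Polynomial.X ^ 4 * (p + 1) +
      10 * Polynomial.X ^ 4 * (p + 1) * (Polynomial.X * Polynomial.X), fun I => ?_⟩
    have hlen : (votes I.1).length ≤ 10 * I.1.m ^ 4 * (p.eval I.1.m + 1) :=
      (Nat.le_add_right _ _).trans ((hvotes I.1).length_add_le.trans
        (Nat.mul_le_mul_left _ (by have := I.2; omega)))
    have henc := CMInstance.encode_length_le ⟨I.1.m, I.1.c, I.1.numManip, votes I.1⟩
    have hmul := Nat.mul_le_mul_right (I.1.m * I.1.m) hlen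
    have hM := I.2
    simp only [coalitionalManipulation, Polynomial.eval_add, Polynomial.eval_mul,
      Polynomial.eval_pow, Polynomial.eval_X, Polynomial.eval_ofNat, Polynomial.eval_one]
    simp only at henc
    constructor
    · omega
    · omega
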